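/- Let $A$ be a finite alphabet with $|A|\ge 3$, let $A^*$ be the set of finite words over $A$, and let $\preccurlyeq$ be the (scattered) subword ordering on $A^*$: $u\preccurlyeq v$ if $u=u_1\cdots u_n$ and $v=v_0u_1v_1\cdots u_nv_n$ for some words $u_1,\dots,u_n,v_0,\dots,v_n$. Consider first-order logic over the structure $(A^*,\preccurlyeq,(w)_{w\in A^*})$, which has a constant symbol for every word. A $\Sigma_0$-formula and a $\Pi_0$-formula is a quantifier-free formula; for $i\ge 1$, a $\Sigma_i$-formula (resp. $\Pi_i$-formula) is a formula $\exists x_1\cdots\exists x_n\,\varphi$ (resp. $\forall x_1\cdots\forall x_n\,\varphi$) with $n\ge 0$ and $\varphi$ a $\Pi_{i-1}$-formula (resp. $\Sigma_{i-1}$-formula). A formula with free variables $x_1,\dots,x_k$ defines the relation $R\subseteq(A^*)^k$ of all tuples that satisfy it. Let $\Sigma_1^0$ be the class of recursively enumerable relations and, for $i\ge 2$, let $\Sigma_i^0$ be the class of relations that are recursively enumerable with an oracle for some relation in $\Sigma_{i-1}^0$ (words and tuples of words being coded effectively). Then for every $i\ge 1$, every $k\ge 0$ and every relation $R\subseteq(A^*)^k$,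 the relation $R$ is definable by a $\Sigma_i$-formula over $(A^*,\preccurlyeq,(w)_{w\in A^*})$ if and only if $R$ belongs to $\Sigma_i^0$. -/

import Mathlib

open FirstOrder

/-! ### First-order logic over the subword ordering -/

/-- The relation symbols of subword logic: one binary symbol. -/
inductive SubwordRel : ℕ → Type
  | subword : SubwordRel 2

/-- The first-order language with a single binary relation symbol. The language with a constant
symbol for every word over `A` is `subwordLanguage[[List A]]`. -/
def subwordLanguage : Language := ⟨fun _ => Empty, SubwordRel⟩

/-- The set of words `List A` as a structure: the binary relation symbol is interpreted as the
(scattered) subword ordering. In `subwordLanguage[[List A]]`, Mathlib interprets the constant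
symbol of a word as that word. -/
instance subwordStructure (A : Type*) : subwordLanguage.Structure (List A) where
  funMap := fun f => f.elim
  RelMap := fun r =>
    match r with
    | SubwordRel.subword => fun v => (v 0).Sublist (v 1)

/-- The two kinds of quantifiers. -/
inductive Quantifier : Type
  | ex
  | all

/-- The other kind of quantifier. -/
def Quantifier.dual : Quantifier → Quantifier
  | .ex => .all
  | .all => .ex

/-- `IsAlternating q i φ`: the formula `φ` is prenex, with `i` (possibly empty) blocks of equal
quantifiers whose kinds alternate, the outermost block being of kind `q`. At level `0` these are
the quantifier-free formulas; at level `i + 1` they consist of a block of `q`-quantifiers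
followed by a formula of level `i` for the dual kind. -/
inductive IsAlternating {L : Language} {α : Type*} :
    Quantifier → ℕ → ∀ {n : ℕ}, L.BoundedFormula α n → Prop
  | of_isQF {q : Quantifier} {n : ℕ} {φ : L.BoundedFormula α n} (h : φ.IsQF) :
      IsAlternating q 0 φ
  | of_dual {q : Quantifier} {i n : ℕ} {φ : L.BoundedFormula α n}
      (h : IsAlternating q.dual i φ) : IsAlternating q (i + 1) φ
  | ex {i n : ℕ} {φ : L.BoundedFormula α (n + 1)}
      (h : IsAlternating Quantifier.ex (i + 1) φ) : IsAlternating Quantifier.ex (i + 1) φ.ex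
  | all {i n : ℕ} {φ : L.BoundedFormula α (n + 1)}
      (h : IsAlternating Quantifier.all (i + 1) φ) : IsAlternating Quantifier.all (i + 1) φ.all

/-- The `Σ_i`-formulas. -/
def IsSigmaFormula {L : Language} {α : Type*} {n : ℕ} (i : ℕ) (φ : L.BoundedFormula α n) : Prop :=
  IsAlternating Quantifier.ex i φ

/-- The relation `R ⊆ (A^*)^k` is defined by a `Σ_i`-formula with free variables indexed by
`Fin k` over the words with the subword ordering and a constant for every word. -/
def SigmaDefinable {A : Type*} {k : ℕ} (i : ℕ) (R : Set (Fin k → List A)) : Prop :=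
  ∃ φ : subwordLanguage[[List A]].Formula (Fin k),
    IsSigmaFormula i φ ∧ ∀ v : Fin k → List A, v ∈ R ↔ φ.Realize v

/-! ### The arithmetical hierarchy -/

open Classical in
/-- The membership oracle of a set of natural numbers. -/
noncomputable def membershipOracle (T : Set ℕ) : ℕ →. ℕ :=
  fun n => Part.some (if n ∈ T then 1 else 0)

/-- `S` is recursively enumerable relative to `T`: it is the domain of a semi-decision procedure
that has access to the membership oracle of `T`. -/
def REIn (T S : Set ℕ) : Prop :=
  RecursiveIn {membershipOracle T} fun n => Part.assert (n ∈ S) fun _ => Part.some ()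

/-- The levels `Σ_i^0` of the arithmetical hierarchy for sets of natural numbers: `Σ_1^0` is
the class of recursively enumerable sets, and `Σ_i^0` for `i ≥ 2` is the class of sets that are
recursively enumerable with an oracle in `Σ_{i-1}^0`. (Level `0` is by convention the class of
decidable sets.) -/
def ArithmeticalSigma : ℕ → Set ℕ → Prop
  | 0, S => ComputablePred fun n => n ∈ S
  | 1, S => REPred fun n => n ∈ S
  | i + 2, S => ∃ T : Set ℕ, ArithmeticalSigma (i + 1) T ∧ REIn T S

/-- A set of elements of an effectively coded type, in particular a relation on words, belongs to
`Σ_i^0` if the set of the codes of its elements does. -/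
def InSigmaZero {α : Type*} [Primcodable α] (i : ℕ) (R : Set α) : Prop :=
  ArithmeticalSigma i (Encodable.encode '' R)

/-!
A vector `n₁, …, n_r` of natural numbers is encoded by the word `a^{n₁} b ⋯ a^{n_r} b`. Over at
least three letters, concatenation of words is definable by a `Σ₁`-formula: a word is determined by
its projections to two letters, and the third letter serves as a marker in the comparison of such
projections. Hence entrywise conditions on encoded vectors are definable as soon as the condition
on the entries is, and so are transitive closures, since a chain is a vector followed by its shift.
Primitive recursion and unbounded search are transitive closures of simple steps; in this way the
graphs of functions that are recursive in a definable oracle and its complement become definable,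
and induction on the levels yields all of the arithmetical hierarchy. Conversely, the subword
ordering is decidable, and every block of quantifiers amounts to a single unbounded search.
-/

/-! ### The quantifier hierarchy, semantically -/

section Hierarchy

open Language BoundedFormula

variable {L : Language} {M : Type*} [L.Structure M] {ι κ : Type} {R S : (ι → M) → Prop} {i : ℕ}

variable (L) in
/-- The relations, with variables indexed by `ι`, that are defined by a quantifier-free formula. -/
def QFDef (R : (ι → M) → Prop) : Prop :=
  ∃ φ : L.Formula ι, φ.IsQF ∧ ∀ v, φ.Realize v ↔ R v

variable (L) in
/-- The relations defined by `Σ_i`-formulas, described without syntax above level `0`: level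
`i + 1` consists of the finite blocks of existential quantifiers over negations of relations of
level `i`. Unlike for formulas, the blocks may be indexed by any finite type. -/
def SigDef : ℕ → ∀ {ι : Type}, ((ι → M) → Prop) → Prop
  | 0, _, R => QFDef L R
  | i + 1, ι, R => ∃ (κ : Type) (_ : Finite κ) (R' : (ι ⊕ κ → M) → Prop),
      SigDef i R' ∧ ∀ v, R v ↔ ∃ w : κ → M, ¬ R' (Sum.elim v w)

theorem QFDef.not (h : QFDef L R) : QFDef L fun v => ¬ R v := by
  obtain ⟨φ, hφ, h⟩ := h
  exact ⟨φ.not, hφ.not, fun v => Formula.realize_not.trans (h v).not⟩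

theorem QFDef.and (hR : QFDef L R) (hS : QFDef L S) : QFDef L fun v => R v ∧ S v := by
  obtain ⟨φ, hφ, h⟩ := hR
  obtain ⟨ψ, hψ, h'⟩ := hS
  exact ⟨φ ⊓ ψ, hφ.inf hψ, fun v => Formula.realize_inf.trans (and_congr (h v) (h' v))⟩

theorem QFDef.or (hR : QFDef L R) (hS : QFDef L S) : QFDef L fun v => R v ∨ S v :=
  (by simpa only [not_and_or, not_not] using (hR.not.and hS.not).not)

theorem QFDef.reindex (f : ι → κ) (h : QFDef L R) : QFDef L fun v : κ → M => R (v ∘ f) := by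
  obtain ⟨φ, hφ, h⟩ := h
  exact ⟨φ.relabel f, hφ.relabel _, fun v => Formula.realize_relabel.trans (h _)⟩

theorem SigDef.congr (h : SigDef L i R) (e : ∀ v, S v ↔ R v) : SigDef L i S := by
  rwa [show S = R from funext fun v => propext (e v)]

theorem SigDef.reindex (f : ι → κ) (h : SigDef L i R) :
    SigDef L i fun v : κ → M => R (v ∘ f) := by
  induction i generalizing ι κ with
  | zero => exact QFDef.reindex f h
  | succ i ih =>
    obtain ⟨τ, hτ, R', hR', e⟩ := h
    refine ⟨τ, hτ, _, ih (Sum.map f id) hR', fun v => ?_⟩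
    simp only [e, Sum.elim_comp_map, Function.comp_id]

theorem SigDef.and_or [Nonempty M] (hR : SigDef L i R) (hS : SigDef L i S) :
    SigDef L i (fun v => R v ∧ S v) ∧ SigDef L i (fun v => R v ∨ S v) := by
  induction i generalizing ι with
  | zero => exact ⟨QFDef.and hR hS, QFDef.or hR hS⟩
  | succ i ih =>
    obtain ⟨κ, hκ, R', hR', e⟩ := hR
    obtain ⟨τ, hτ, S', hS', e'⟩ := hS
    have h := ih (hR'.reindex (Sum.map id (Sum.inl : κ → κ ⊕ τ)))
      (hS'.reindex (Sum.map id (Sum.inr : τ → κ ⊕ τ)))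
    refine ⟨⟨κ ⊕ τ, inferInstance, _, h.2, fun v => ?_⟩,
      ⟨κ ⊕ τ, inferInstance, _, h.1, fun v => ?_⟩⟩ <;>
      simp only [e, e', Sum.elim_comp_map, Function.comp_id, not_or, not_and_or]
    · constructor
      · rintro ⟨⟨w, hw⟩, ⟨w', hw'⟩⟩
        exact ⟨Sum.elim w w', hw, hw'⟩
      · rintro ⟨w, hw⟩
        exact ⟨⟨_, hw.1⟩, ⟨_, hw.2⟩⟩
    · constructor
      · rintro (⟨w, hw⟩ | ⟨w, hw⟩)
        · exact ⟨Sum.elim w fun _ => Classical.arbitrary M, .inl hw⟩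
        · exact ⟨Sum.elim (fun _ => Classical.arbitrary M) w, .inr hw⟩
      · rintro ⟨w, hw⟩
        exact hw.imp (fun h => ⟨_, h⟩) fun h => ⟨_, h⟩

theorem SigDef.and [Nonempty M] (hR : SigDef L i R) (hS : SigDef L i S) :
    SigDef L i fun v => R v ∧ S v :=
  (hR.and_or hS).1

theorem SigDef.or [Nonempty M] (hR : SigDef L i R) (hS : SigDef L i S) :
    SigDef L i fun v => R v ∨ S v :=
  (hR.and_or hS).2

theorem SigDef.not (h : SigDef L i R) : SigDef L (i + 1) fun v => ¬ R v :=
  ⟨Empty, inferInstance, _, h.reindex Sum.inl, fun v => by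
    simp only [Sum.elim_comp_inl, exists_const]⟩

theorem SigDef.succ (h : SigDef L i R) : SigDef L (i + 1) R := by
  induction i generalizing ι with
  | zero => exact (SigDef.not (i := 0) (QFDef.not h)).congr fun v => not_not.symm
  | succ i ih =>
    obtain ⟨κ, hκ, R', hR', e⟩ := h
    exact ⟨κ, hκ, R', ih hR', e⟩

theorem SigDef.of_qfDef (h : QFDef L R) : SigDef L i R := by
  induction i with
  | zero => exact h
  | succ i ih => exact ih.succ

theorem SigDef.exists_fun [Finite κ] {P : (ι → M) → (κ → M) → Prop}
    (h : SigDef L (i + 1) fun v : ι ⊕ κ → M => P (fun x => v (.inl x)) fun y => v (.inr y)) :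
    SigDef L (i + 1) fun v => ∃ w, P v w := by
  obtain ⟨τ, hτ, R', hR', e⟩ := h
  have key (v : ι → M) (w : κ → M) (z : τ → M) :
      Sum.elim v (Sum.elim w z) ∘ Equiv.sumAssoc ι κ τ = Sum.elim (Sum.elim v w) z := by
    funext x
    rcases x with (x | x) | x <;> rfl
  refine ⟨κ ⊕ τ, inferInstance, _, hR'.reindex (Equiv.sumAssoc ι κ τ), fun v => ?_⟩
  constructor
  · rintro ⟨w, hw⟩
    obtain ⟨z, hz⟩ := (e (Sum.elim v w)).1 hw
    exact ⟨Sum.elim w z, by rwa [key]⟩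
  · rintro ⟨w, hw⟩
    rw [← Sum.elim_comp_inl_inr w, key] at hw
    exact ⟨w ∘ .inl, (e (Sum.elim v _)).2 ⟨_, hw⟩⟩

theorem SigDef.ex {P : (ι → M) → M → Prop}
    (h : SigDef L (i + 1) fun v : Option ι → M => P (fun x => v (some x)) (v none)) :
    SigDef L (i + 1) fun v => ∃ x, P v x := by
  have := h.reindex (κ := ι ⊕ Unit) fun o => o.elim (.inr ()) .inl
  refine (SigDef.exists_fun (κ := Unit) (P := fun v w => P v (w ())) this).congr fun v => ?_
  exact ⟨fun ⟨x, hx⟩ => ⟨fun _ => x, hx⟩, fun ⟨w, hw⟩ => ⟨_, hw⟩⟩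

theorem SigDef.prop (p : Prop) : SigDef L i fun _ : ι → M => p := by
  by_cases h : p
  · exact .of_qfDef ⟨⊤, IsQF.top, fun v => by simp [h]⟩
  · exact .of_qfDef ⟨⊥, isQF_bot, fun v => by simp [h]⟩

theorem SigDef.forall_finite [Nonempty M] {β : Type*} [Finite β] {P : β → (ι → M) → Prop}
    (h : ∀ b, SigDef L i (P b)) : SigDef L i fun v => ∀ b, P b v := by
  suffices ∀ s : Set β, s.Finite → SigDef L i fun v => ∀ b ∈ s, P b v from
    (this _ Set.finite_univ).congr fun v => by simp only [Set.mem_univ, forall_const]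
  intro s hs
  induction s, hs using Set.Finite.induction_on with
  | empty => exact (SigDef.prop True).congr fun v => by simp
  | @insert b s _ _ ih => exact ((h b).and ih).congr fun v => Set.forall_mem_insert ..

end Hierarchy

section Prenex

open Language BoundedFormula

variable {L : Language} {M : Type*} [L.Structure M] {ι κ : Type} {q : Quantifier} {i n : ℕ}

/-- The proposition itself for an existential, its negation for a universal quantifier. With it,
a block of `q`-quantifiers is an existential statement for both kinds `q`. -/
def Quantifier.polarity : Quantifier → Prop → Prop
  | .ex, p => p
  | .all, p => ¬ p

theorem Quantifier.polarity_dual (p : Prop) : q.dual.polarity p ↔ ¬ q.polarity p := by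
  cases q
  · exact Iff.rfl
  · exact not_not.symm

theorem isQF_toFormula {φ : L.BoundedFormula ι n} (h : φ.IsQF) : φ.toFormula.IsQF := by
  induction h with
  | falsum => exact isQF_bot
  | of_isAtomic h =>
    cases h with
    | equal t₁ t₂ => exact (IsAtomic.equal _ _).isQF
    | rel r ts => exact (IsAtomic.rel _ _).isQF
  | imp _ _ ih₁ ih₂ => exact ih₁.imp ih₂

theorem SigDef.exists_snoc {P : (ι → M) → (Fin (n + 1) → M) → Prop}
    (h : SigDef L (i + 1) fun v : ι ⊕ Fin (n + 1) → M => P (v ∘ .inl) (v ∘ .inr)) :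
    SigDef L (i + 1) fun v : ι ⊕ Fin n → M =>
      ∃ a, P (v ∘ .inl) (Fin.snoc (α := fun _ => M) (v ∘ .inr) a) := by
  refine SigDef.ex ((h.reindex (κ := Option (ι ⊕ Fin n))
    (Sum.elim (fun x => some (.inl x)) (Fin.snoc (fun y => some (.inr y)) none))).congr
    fun v => Eq.to_iff ?_)
  congr 1
  funext y
  refine Fin.lastCases ?_ (fun y => ?_) y <;> simp

theorem IsAlternating.sigDef {φ : L.BoundedFormula ι n} (h : IsAlternating q i φ) :
    SigDef L i fun v : ι ⊕ Fin n → M => q.polarity (φ.Realize (v ∘ .inl) (v ∘ .inr)) := by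
  induction h with
  | @of_isQF q n φ h =>
    have hφ : QFDef L fun v : ι ⊕ Fin n → M => φ.Realize (v ∘ .inl) (v ∘ .inr) :=
      ⟨φ.toFormula, isQF_toFormula h, fun v => realize_toFormula φ v⟩
    cases q with
    | ex => exact hφ
    | all => exact hφ.not
  | of_dual _ ih => exact ih.not.congr fun v => by rw [Quantifier.polarity_dual, not_not]
  | @ex i n φ _ ih =>
    exact (SigDef.exists_snoc (P := fun v w => φ.Realize v w) ih).congr fun v => realize_ex
  | @all i n φ _ ih =>
    exact (SigDef.exists_snoc (P := fun v w => ¬ φ.Realize v w) ih).congr fun v =>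
      realize_all.not.trans not_forall

theorem IsAlternating.exists_quantify {φ : L.BoundedFormula ι (n + 1)}
    (h : IsAlternating q (i + 1) φ) : ∃ ψ : L.BoundedFormula ι n, IsAlternating q (i + 1) ψ ∧
      ∀ (v : ι → M) (xs : Fin n → M), q.polarity (ψ.Realize v xs) ↔
        ∃ a, q.polarity (φ.Realize v (Fin.snoc xs a)) := by
  cases q with
  | ex => exact ⟨φ.ex, h.ex, fun v xs => realize_ex⟩
  | all => exact ⟨φ.all, h.all, fun v xs => realize_all.not.trans not_forall⟩

theorem IsAlternating.exists_block {m : ℕ} {φ : L.BoundedFormula ι (n + m)}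
    (h : IsAlternating q (i + 1) φ) : ∃ ψ : L.BoundedFormula ι n, IsAlternating q (i + 1) ψ ∧
      ∀ (v : ι → M) (xs : Fin n → M), q.polarity (ψ.Realize v xs) ↔
        ∃ ys : Fin m → M, q.polarity (φ.Realize v (Fin.append xs ys)) := by
  induction m with
  | zero =>
    refine ⟨φ, h, fun v xs => ?_⟩
    have append_eq (ys : Fin 0 → M) : Fin.append xs ys = xs := by
      rw [Subsingleton.elim ys Fin.elim0, Fin.append_elim0]
      rfl
    simp only [append_eq, exists_const]
  | succ m ih =>
    obtain ⟨χ, hχ, eχ⟩ := h.exists_quantify (n := n + m) (M := M)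
    obtain ⟨ψ, hψ, eψ⟩ := ih hχ
    refine ⟨ψ, hψ, fun v xs => ?_⟩
    have snoc_append (ys : Fin m → M) (a : M) :
        (Fin.snoc (Fin.append xs ys) a : Fin (n + m + 1) → M) =
          Fin.append xs (Fin.snoc ys a : Fin (m + 1) → M) := by
      rw [Fin.append_snoc]
    simp only [eψ, eχ, snoc_append]
    exact ⟨fun ⟨ys, a, h⟩ => ⟨_, h⟩,
      fun ⟨ys, h⟩ => ⟨Fin.init ys, ys (Fin.last m), by rwa [Fin.snoc_init_self]⟩⟩

theorem SigDef.exists_formula {R : (ι ⊕ Fin n → M) → Prop} (h : SigDef L i R) (q : Quantifier) :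
    ∃ φ : L.BoundedFormula ι n, IsAlternating q i φ ∧
      ∀ v xs, q.polarity (φ.Realize v xs) ↔ R (Sum.elim v xs) := by
  induction i generalizing n q with
  | zero =>
    obtain ⟨φ, hφ, e⟩ := h
    have hqf : (relabel (n := n) id φ).IsQF := hφ.relabel id
    have realize_iff (v : ι → M) (xs : Fin n → M) :
        (relabel (n := n) id φ).Realize v xs ↔ R (Sum.elim v xs) := by
      rw [← e, Formula.Realize, realize_relabel]
      exact Eq.to_iff (congrArg _ (Subsingleton.elim _ _))
    cases q with
    | ex => exact ⟨_, .of_isQF hqf, realize_iff⟩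
    | all => exact ⟨_, .of_isQF hqf.not, fun v xs =>
        realize_not.not.trans (not_not.trans (realize_iff v xs))⟩
  | succ i ih =>
    obtain ⟨κ, hκ, R', hR', e⟩ := h
    obtain ⟨m, ⟨f⟩⟩ := Finite.exists_equiv_fin κ
    let g : (ι ⊕ Fin n) ⊕ κ → ι ⊕ Fin (n + m) :=
      Sum.elim (Sum.map id (Fin.castAdd m)) fun y => .inr (Fin.natAdd n (f y))
    have elim_comp (v : ι → M) (xs : Fin n → M) (ys : Fin m → M) :
        Sum.elim v (Fin.append xs ys) ∘ g = Sum.elim (Sum.elim v xs) (ys ∘ f) := by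
      funext x
      rcases x with (x | x) | x <;> simp [g]
    obtain ⟨φ, hφ, eφ⟩ := ih (hR'.reindex g) q.dual
    obtain ⟨ψ, hψ, eψ⟩ := (IsAlternating.of_dual hφ).exists_block (M := M)
    refine ⟨ψ, hψ, fun v xs => ?_⟩
    rw [eψ, e, (f.symm.arrowCongr (Equiv.refl M)).surjective.exists]
    refine exists_congr fun ys => ?_
    rw [← not_iff_not, ← Quantifier.polarity_dual, eφ, elim_comp, not_not]
    rfl

end Prenex

/-! ### Existentially definable relations on words -/

section Atomic

open Language

variable {A : Type*} {ι : Type} {i : ℕ}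

variable (A) in
/-- The relations on words over `A` at level `i` of the hierarchy for the subword ordering with a
constant for every word. -/
abbrev WordDef (i : ℕ) (R : (ι → List A) → Prop) : Prop :=
  SigDef (subwordLanguage[[List A]]) i R

theorem sigmaDefinable_iff_wordDef {k : ℕ} {R : Set (Fin k → List A)} :
    SigmaDefinable i R ↔ WordDef A i fun v => v ∈ R := by
  constructor
  · rintro ⟨φ, hφ, e⟩
    have := (IsAlternating.sigDef (M := List A) hφ).reindex (κ := Fin k) (Sum.elim id Fin.elim0)
    refine SigDef.congr this fun v => ?_
    rw [e]
    exact Eq.to_iff (congrArg (BoundedFormula.Realize φ v) (Subsingleton.elim _ _))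
  · intro h
    obtain ⟨φ, hφ, e⟩ := (h.reindex (κ := Fin k ⊕ Fin 0) Sum.inl).exists_formula .ex
    refine ⟨φ, hφ, fun v => ?_⟩
    rw [Formula.Realize]
    exact (e v _).symm

/-- The term for a variable or a constant. -/
def wordTerm : ι ⊕ List A → (subwordLanguage[[List A]]).Term (ι ⊕ Fin 0)
  | .inl x => Term.var (.inl x)
  | .inr c => (subwordLanguage.con c).term

theorem realize_wordTerm (v : ι → List A) (xs : Fin 0 → List A) (s : ι ⊕ List A) :
    (wordTerm s).realize (Sum.elim v xs) = Sum.elim v id s := by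
  cases s with
  | inl x => rfl
  | inr c => exact Term.realize_constants

theorem QFDef.sublist (s t : ι ⊕ List A) :
    QFDef (subwordLanguage[[List A]]) fun v => (Sum.elim v id s).Sublist (Sum.elim v id t) := by
  let subword : (subwordLanguage[[List A]]).Relations 2 := .inl SubwordRel.subword
  refine ⟨subword.boundedFormula₂ (wordTerm s) (wordTerm t),
    (BoundedFormula.IsAtomic.rel _ _).isQF, fun v => ?_⟩
  rw [Formula.Realize, BoundedFormula.realize_rel₂, realize_wordTerm, realize_wordTerm]
  exact Iff.rfl

namespace SigDef

theorem sublist (x y : ι) : WordDef A i fun v => (v x).Sublist (v y) :=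
  .of_qfDef (.sublist (.inl x) (.inl y))

theorem not_sublist (x y : ι) : WordDef A i fun v => ¬ (v x).Sublist (v y) :=
  .of_qfDef (QFDef.sublist (.inl x) (.inl y)).not

theorem const_sublist (c : List A) (x : ι) :
    WordDef A i fun v => c.Sublist (v x) :=
  .of_qfDef (.sublist (.inr c) (.inl x))

theorem const_not_sublist (c : List A) (x : ι) :
    WordDef A i fun v => ¬ c.Sublist (v x) :=
  .of_qfDef (QFDef.sublist (.inr c) (.inl x)).not

theorem eq_const (c : List A) (x : ι) : WordDef A i fun v => v x = c := by
  refine ((SigDef.of_qfDef (.sublist (.inl x) (.inr c))).and (const_sublist c x)).congr fun _ =>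
    ⟨fun h => ?_, fun h => h.1.antisymm h.2⟩
  exact ⟨h ▸ List.Sublist.refl _, h ▸ List.Sublist.refl _⟩

theorem eq (x y : ι) : WordDef A i fun v => v x = v y :=
  ((sublist x y).and (sublist y x)).congr fun _ =>
    ⟨fun h => ⟨by rw [h], by rw [h]⟩, fun h => h.1.antisymm h.2⟩

theorem forall_mem [Finite A] (B : A → Prop) (x : ι) :
    WordDef A i fun v => ∀ s ∈ v x, B s := by
  have : WordDef A i fun v => ∀ s : A, B s ∨ ¬ [s].Sublist (v x) :=
    forall_finite fun s => (prop _).or (const_not_sublist _ _)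
  refine this.congr fun v => forall_congr' fun s => ?_
  rw [List.singleton_sublist]
  tauto

end SigDef

end Atomic

section Blocks

variable {A : Type*} {p q : A}

theorem sublist_of_append_cons_sublist [DecidableEq A] {r : A} {x x' y y' : List A} (hx : r ∉ x)
    (hy : r ∉ y) (hc : x'.count r = y'.count r) (h : (x ++ r :: x').Sublist (y ++ r :: y')) :
    x.Sublist y ∧ x'.Sublist y' := by
  induction y generalizing x with
  | nil =>
    cases x with
    | nil => exact ⟨List.Sublist.refl _, List.cons_sublist_cons.1 h⟩
    | cons a x =>
      have ha : a ≠ r := (List.ne_of_not_mem_cons hx).symm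
      have h' : (a :: x ++ r :: x').Sublist y' := h.of_cons_of_ne ha
      have := h'.count_le r
      rw [List.count_append, List.count_cons_self] at this
      omega
  | cons b y ih =>
    obtain ⟨hb, hy'⟩ := not_or.1 (List.mem_cons.not.1 hy)
    cases x with
    | nil =>
      exact ⟨List.nil_sublist _, (ih (x := []) hx hy' (h.of_cons_of_ne hb)).2⟩
    | cons a x =>
      cases h with
      | cons _ h =>
        have := ih hx hy' h
        exact ⟨this.1.cons _, this.2⟩
      | cons_cons _ h =>
        have := ih (List.not_mem_of_not_mem_cons hx) hy' h
        exact ⟨this.1.cons_cons _, this.2⟩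

theorem exists_eq_append_cons_of_count_eq_one [DecidableEq A] {r : A} {x : List A}
    (h : x.count r = 1) : ∃ y z, x = y ++ r :: z ∧ r ∉ y ∧ r ∉ z := by
  obtain ⟨y, z, rfl, hy⟩ := List.eq_append_cons_of_mem (List.one_le_count_iff.1 h.ge)
  refine ⟨y, z, rfl, hy, ?_⟩
  rw [List.count_append, List.count_eq_zero.2 hy, List.count_cons_self] at h
  exact List.count_eq_zero.1 (by omega)

/-- The word `p^m q p^k`. -/
def block (p q : A) (m k : ℕ) : List A :=
  List.replicate m p ++ q :: List.replicate k p

theorem mem_block {m k : ℕ} {s : A} (hs : s ∈ block p q m k) : s = p ∨ s = q := by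
  simp only [block, List.mem_append, List.mem_cons, List.mem_replicate] at hs
  tauto

theorem count_right_block [DecidableEq A] (hpq : p ≠ q) (m k : ℕ) :
    (block p q m k).count q = 1 := by
  simp [block, List.count_replicate, hpq]

theorem count_left_block [DecidableEq A] (hpq : p ≠ q) (m k : ℕ) :
    (block p q m k).count p = m + k := by
  simp [block, hpq.symm]

theorem exists_eq_block_iff [DecidableEq A] (hpq : p ≠ q) {W : List A} :
    (∃ m k, W = block p q m k) ↔ (∀ s ∈ W, s = p ∨ s = q) ∧ W.count q = 1 := by
  constructor
  · rintro ⟨m, k, rfl⟩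
    exact ⟨fun s => mem_block, count_right_block hpq m k⟩
  · rintro ⟨hW, h⟩
    obtain ⟨y, z, rfl, hy, hz⟩ := exists_eq_append_cons_of_count_eq_one h
    refine ⟨y.length, z.length, ?_⟩
    rw [block, ← List.eq_replicate_length.2 fun s hs => ?_,
      ← List.eq_replicate_length.2 fun s hs => ?_]
    · exact (hW s (by simp [hs])).resolve_right fun e => hz (e ▸ hs)
    · exact (hW s (by simp [hs])).resolve_right fun e => hy (e ▸ hs)

theorem block_sublist_block (hpq : p ≠ q) {m k m' k' : ℕ} :
    (block p q m k).Sublist (block p q m' k') ↔ m ≤ m' ∧ k ≤ k' := by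
  classical
  have hq (n : ℕ) : q ∉ List.replicate n p := fun h => hpq (List.eq_of_mem_replicate h).symm
  constructor
  · intro h
    simpa only [List.replicate_sublist_replicate] using
      sublist_of_append_cons_sublist (hq m) (hq m')
        (by rw [List.count_eq_zero.2 (hq k), List.count_eq_zero.2 (hq k')]) h
  · rintro ⟨hm, hk⟩
    exact ((List.replicate_sublist_replicate p).2 hm).append
      (((List.replicate_sublist_replicate p).2 hk).cons_cons q)

theorem replicate_sublist_block (hpq : p ≠ q) {n m k : ℕ} :
    (List.replicate n p).Sublist (block p q m k) ↔ n ≤ m + k := by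
  classical
  rw [List.replicate_sublist_iff, count_left_block hpq]

theorem block_inj (hpq : p ≠ q) {m k m' k' : ℕ} :
    block p q m k = block p q m' k' ↔ m = m' ∧ k = k' := by
  refine ⟨fun h => ?_, fun ⟨hm, hk⟩ => hm ▸ hk ▸ rfl⟩
  have hle : (block p q m k).Sublist (block p q m' k') := h ▸ .refl _
  have hge : (block p q m' k').Sublist (block p q m k) := h ▸ .refl _
  rw [block_sublist_block hpq] at hle hge
  omega

theorem exists_eq_block_left_iff (hpq : p ≠ q) {W : List A} (d : ℕ) :
    (∃ m, W = block p q m d) ↔ (∃ m k, W = block p q m k) ∧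
      (block p q 0 d).Sublist W ∧ ¬ (block p q 0 (d + 1)).Sublist W := by
  constructor
  · rintro ⟨m, rfl⟩
    refine ⟨⟨m, d, rfl⟩, ?_⟩
    simp only [block_sublist_block hpq]
    omega
  · rintro ⟨⟨m, k, rfl⟩, h⟩
    simp only [block_sublist_block hpq] at h
    exact ⟨m, by rw [show k = d by omega]⟩

/-- Pins down `x` and `y` by the chain `m' < m ≤ m'' < l - d ≤ m' + 2`, where `x = p^l`,
`y = p^m q`, `W = p^m' q p^(d+2)` and `Z = p^m'' q p^d`. -/
theorem exists_eq_replicate_and_eq_block_iff (hpq : p ≠ q) (d : ℕ) (x y : List A) :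
    (∃ n, x = List.replicate (n + d + 2) p ∧ y = block p q (n + 1) 0) ↔
      (∀ s ∈ x, s = p) ∧ (∃ m, y = block p q m 0) ∧ ∃ W Z, (∃ m, W = block p q m (d + 2)) ∧
        (∃ m, Z = block p q m d) ∧ ¬ y.Sublist W ∧ y.Sublist Z ∧ ¬ x.Sublist Z ∧ x.Sublist W := by
  constructor
  · rintro ⟨n, rfl, rfl⟩
    refine ⟨fun s => List.eq_of_mem_replicate, ⟨_, rfl⟩, _, _, ⟨n, rfl⟩, ⟨n + 1, rfl⟩, ?_⟩
    simp only [block_sublist_block hpq, replicate_sublist_block hpq]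
    omega
  · rintro ⟨hx, ⟨m, rfl⟩, _, _, ⟨m', rfl⟩, ⟨m'', rfl⟩, h⟩
    rw [List.eq_replicate_length.2 hx] at h ⊢
    simp only [block_sublist_block hpq, replicate_sublist_block hpq] at h
    exact ⟨m', by congr 1; omega, by rw [show m = m' + 1 by omega]⟩

end Blocks

namespace SigDef

variable {A : Type*} {p q : A} {ι : Type} {i : ℕ}

theorem count_eq_one [DecidableEq A] (r : A) (x : ι) :
    WordDef A i fun v => (v x).count r = 1 := by
  refine ((const_sublist [r] x).and (const_not_sublist [r, r] x)).congr fun v => ?_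
  have h₁ := List.replicate_sublist_iff (n := 1) (a := r) (l := v x)
  have h₂ := List.replicate_sublist_iff (n := 2) (a := r) (l := v x)
  simp only [List.replicate] at h₁ h₂
  rw [h₁, h₂]
  omega

variable [Finite A]

theorem exists_eq_block (hpq : p ≠ q) (x : ι) :
    WordDef A i fun v => ∃ m k, v x = block p q m k := by
  classical
  exact (SigDef.and (.forall_mem _ _) (.count_eq_one _ _)).congr fun _ => exists_eq_block_iff hpq

theorem exists_eq_block_left (hpq : p ≠ q) (x : ι) (d : ℕ) :
    WordDef A i fun v => ∃ m, v x = block p q m d :=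
  (SigDef.and (.exists_eq_block hpq _) (.and (.const_sublist _ _) (.const_not_sublist _ _))).congr
    fun _ => exists_eq_block_left_iff hpq d

theorem exists_eq_replicate_and_eq_block (hpq : p ≠ q) (d : ℕ) (x y : ι) :
    WordDef A (i + 1) fun v =>
      ∃ n, v x = List.replicate (n + d + 2) p ∧ v y = block p q (n + 1) 0 := by
  simp only [_root_.exists_eq_replicate_and_eq_block_iff hpq]
  exact .and (.forall_mem _ _) (.and (.exists_eq_block_left hpq _ _) (.ex (.ex (.and
    (.exists_eq_block_left hpq _ _) (.and (.exists_eq_block_left hpq _ _)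
    (.and (.not_sublist _ _) (.and (.sublist _ _) (.and (.not_sublist _ _) (.sublist _ _)))))))))

theorem exists_eq_replicate_succ (hpq : p ≠ q) (x y : ι) : WordDef A (i + 1) fun v =>
    ∃ n, v x = List.replicate n p ∧ v y = List.replicate (n + 1) p := by
  have h : WordDef A (i + 1) fun v => ((v x = [] ∧ v y = [p]) ∨
      (v x = [p] ∧ v y = [p, p])) ∨
      ∃ z, (∃ n, v x = List.replicate (n + 0 + 2) p ∧ z = block p q (n + 1) 0) ∧
        (∃ n, v y = List.replicate (n + 1 + 2) p ∧ z = block p q (n + 1) 0) :=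
    .or (.or (.and (.eq_const _ _) (.eq_const _ _)) (.and (.eq_const _ _) (.eq_const _ _)))
      (.ex (.and (.exists_eq_replicate_and_eq_block hpq 0 _ _)
        (.exists_eq_replicate_and_eq_block hpq 1 _ _)))
  refine h.congr fun v => ?_
  constructor
  · rintro ⟨n, h⟩
    match n with
    | 0 => exact .inl (.inl h)
    | 1 => exact .inl (.inr h)
    | n + 2 => exact .inr ⟨_, ⟨n, h.1, rfl⟩, ⟨n, h.2, rfl⟩⟩
  · rintro ((h | h) | ⟨_, ⟨n, hx, rfl⟩, ⟨m, hy, e⟩⟩)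
    · exact ⟨0, h⟩
    · exact ⟨1, h⟩
    · rw [block_inj hpq] at e
      exact ⟨_, hx, by rw [hy]; congr 1; omega⟩

variable [DecidableEq A]

theorem count_eq (hpq : p ≠ q) (x y : ι) : WordDef A (i + 1) fun v =>
    (v x).count p = (v y).count p := by
  have h : WordDef A (i + 1) fun v => ∃ z z' : List A,
      (∃ n, z = List.replicate n p ∧ z' = List.replicate (n + 1) p) ∧
      (z.Sublist (v x) ∧ ¬ z'.Sublist (v x)) ∧ (z.Sublist (v y) ∧ ¬ z'.Sublist (v y)) :=
    .ex (.ex (.and (.exists_eq_replicate_succ hpq _ _)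
      (.and (.and (.sublist _ _) (.not_sublist _ _)) (.and (.sublist _ _) (.not_sublist _ _)))))
  refine h.congr fun v => ?_
  constructor
  · intro h
    refine ⟨_, _, ⟨(v x).count p, rfl, rfl⟩, ?_⟩
    simp only [List.replicate_sublist_iff]
    omega
  · rintro ⟨_, _, ⟨n, rfl, rfl⟩, h⟩
    simp only [List.replicate_sublist_iff] at h
    omega

theorem count_eq_succ (hpq : p ≠ q) (x y : ι) : WordDef A (i + 1) fun v =>
    (v y).count p = (v x).count p + 1 := by
  have h : WordDef A (i + 1) fun v => ∃ z z' : List A,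
      (∃ n, z = List.replicate n p ∧ z' = List.replicate (n + 1) p) ∧
      z.count p = (v x).count p ∧ z'.count p = (v y).count p :=
    .ex (.ex (.and (.exists_eq_replicate_succ hpq _ _) (.and (.count_eq hpq _ _)
      (.count_eq hpq _ _))))
  refine h.congr fun v => ?_
  constructor
  · intro h
    exact ⟨_, _, ⟨(v x).count p, rfl, rfl⟩, List.count_replicate_self, by
      rw [List.count_replicate_self, h]⟩
  · rintro ⟨_, _, ⟨n, rfl, rfl⟩, h₁, h₂⟩
    rw [List.count_replicate_self] at h₁ h₂
    omega

theorem eq_block_zero_right (hpq : p ≠ q) (x y : ι) : WordDef A (i + 1) fun v =>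
    v y = block p q ((v x).count p) 0 := by
  refine (SigDef.and (.exists_eq_block_left hpq y 0) (.count_eq hpq x y)).congr fun v => ?_
  constructor
  · intro h
    exact ⟨⟨_, h⟩, by rw [h, count_left_block hpq, add_zero]⟩
  · rintro ⟨⟨m, h⟩, e⟩
    rw [e, h, count_left_block hpq, add_zero]

theorem eq_block_zero_left (hpq : p ≠ q) (x y : ι) : WordDef A (i + 1) fun v =>
    v y = block p q 0 ((v x).count p) := by
  refine (SigDef.and (.exists_eq_block hpq y) (.and (.const_not_sublist (block p q 1 0) y)
    (.count_eq hpq x y))).congr fun v => ?_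
  constructor
  · intro h
    refine ⟨⟨_, _, h⟩, ?_, by rw [h, count_left_block hpq, zero_add]⟩
    rw [h, block_sublist_block hpq]
    omega
  · rintro ⟨⟨m, k, h⟩, h', e⟩
    rw [h, block_sublist_block hpq] at h'
    rw [e, h, count_left_block hpq, show m = 0 by omega, zero_add]

theorem exists_eq_block_count_left (hpq : p ≠ q) (x y : ι) :
    WordDef A (i + 1) fun v => ∃ k, v y = block p q ((v x).count p) k := by
  have h : WordDef A (i + 1) fun v => (∃ m k, v y = block p q m k) ∧ ∃ x' U U' : List A,
      x'.count p = (v x).count p + 1 ∧ U = block p q ((v x).count p) 0 ∧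
      U' = block p q (x'.count p) 0 ∧ U.Sublist (v y) ∧ ¬ U'.Sublist (v y) :=
    .and (.exists_eq_block hpq _) (.ex (.ex (.ex (.and (.count_eq_succ hpq _ _)
      (.and (.eq_block_zero_right hpq _ _) (.and (.eq_block_zero_right hpq _ _)
      (.and (.sublist _ _) (.not_sublist _ _))))))))
  refine h.congr fun v => ?_
  constructor
  · rintro ⟨k, e⟩
    refine ⟨⟨_, _, e⟩, List.replicate ((v x).count p + 1) p, _, _, List.count_replicate_self, rfl,
      rfl, ?_⟩
    simp only [e, block_sublist_block hpq, List.count_replicate_self]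
    omega
  · rintro ⟨⟨m, k, e⟩, x', _, _, hx', rfl, rfl, h⟩
    simp only [e, block_sublist_block hpq] at h
    exact ⟨k, by rw [e, show m = (v x).count p by omega]⟩

theorem exists_eq_block_count_right (hpq : p ≠ q) (x y : ι) :
    WordDef A (i + 1) fun v => ∃ m, v y = block p q m ((v x).count p) := by
  have h : WordDef A (i + 1) fun v => (∃ m k, v y = block p q m k) ∧ ∃ x' U U' : List A,
      x'.count p = (v x).count p + 1 ∧ U = block p q 0 ((v x).count p) ∧
      U' = block p q 0 (x'.count p) ∧ U.Sublist (v y) ∧ ¬ U'.Sublist (v y) :=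
    .and (.exists_eq_block hpq _) (.ex (.ex (.ex (.and (.count_eq_succ hpq _ _)
      (.and (.eq_block_zero_left hpq _ _) (.and (.eq_block_zero_left hpq _ _)
      (.and (.sublist _ _) (.not_sublist _ _))))))))
  refine h.congr fun v => ?_
  constructor
  · rintro ⟨m, e⟩
    refine ⟨⟨_, _, e⟩, List.replicate ((v x).count p + 1) p, _, _, List.count_replicate_self, rfl,
      rfl, ?_⟩
    simp only [e, block_sublist_block hpq, List.count_replicate_self]
    omega
  · rintro ⟨⟨m, k, e⟩, x', _, _, hx', rfl, rfl, h⟩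
    simp only [e, block_sublist_block hpq] at h
    exact ⟨m, by rw [e, show k = (v x).count p by omega]⟩

theorem count_add (hpq : p ≠ q) (x y z : ι) : WordDef A (i + 1) fun v =>
    (v x).count p + (v y).count p = (v z).count p := by
  have h : WordDef A (i + 1) fun v => ∃ W : List A,
      (∃ k, W = block p q ((v x).count p) k) ∧ (∃ m, W = block p q m ((v y).count p)) ∧
      W.count p = (v z).count p :=
    .ex (.and (.exists_eq_block_count_left hpq _ _) (.and (.exists_eq_block_count_right hpq _ _)
      (.count_eq hpq _ _)))
  refine h.congr fun v => ?_
  constructor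
  · intro h
    exact ⟨_, ⟨_, rfl⟩, ⟨_, rfl⟩, by rw [count_left_block hpq, h]⟩
  · rintro ⟨_, ⟨k, rfl⟩, ⟨m, e⟩, h⟩
    rw [count_left_block hpq] at h
    rw [block_inj hpq] at e
    omega

end SigDef

/-! ### Concatenation -/

theorem pair_sublist_append_cons_iff {A : Type*} {r s : A} {x y : List A} (hx : r ∉ x) :
    [r, s].Sublist (x ++ r :: y) ↔ s ∈ y := by
  induction x with
  | nil => simp [List.cons_sublist_cons]
  | cons a x ih =>
    obtain ⟨ha, hx⟩ := not_or.1 (List.mem_cons.not.1 hx)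
    exact ⟨fun h => (ih hx).1 (h.of_cons_of_ne ha), fun h => ((ih hx).2 h).cons _⟩

section Projection

variable {A : Type*} [DecidableEq A] {p q r : A}

/-- The projection of a word to the letters `p` and `q`. -/
def proj (p q : A) (x : List A) : List A :=
  x.filter fun s => s = p ∨ s = q

theorem mem_proj {s : A} {x : List A} : s ∈ proj p q x ↔ s ∈ x ∧ (s = p ∨ s = q) := by
  simp only [proj, List.mem_filter, decide_eq_true_eq]

theorem proj_append (p q : A) (x y : List A) : proj p q (x ++ y) = proj p q x ++ proj p q y :=
  List.filter_append ..

theorem proj_cons_left (p q : A) (x : List A) : proj p q (p :: x) = p :: proj p q x :=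
  List.filter_cons_of_pos (by simp)

theorem proj_cons_right (p q : A) (x : List A) : proj p q (q :: x) = q :: proj p q x :=
  List.filter_cons_of_pos (by simp)

theorem proj_cons_of_ne {s : A} (hp : s ≠ p) (hq : s ≠ q) (x : List A) :
    proj p q (s :: x) = proj p q x :=
  List.filter_cons_of_neg (by simp [hp, hq])

theorem proj_eq_self {x : List A} (h : ∀ s ∈ x, s = p ∨ s = q) : proj p q x = x :=
  List.filter_eq_self.2 fun s hs => decide_eq_true (h s hs)

theorem count_proj_left (p q : A) (x : List A) : (proj p q x).count p = x.count p :=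
  List.count_filter (by simp)

theorem count_proj_right (p q : A) (x : List A) : (proj p q x).count q = x.count q :=
  List.count_filter (by simp)

theorem eq_of_sublist_of_count_eq {x y : List A} (h : x.Sublist y)
    (hy : ∀ s ∈ y, s = p ∨ s = q) (hp : x.count p = y.count p) (hq : x.count q = y.count q) :
    x = y := by
  refine h.eq_of_length (List.perm_iff_count.2 fun s => ?_).length_eq
  by_cases hs : s ∈ y
  · rcases hy s hs with rfl | rfl <;> assumption
  · rw [List.count_eq_zero.2 hs, List.count_eq_zero.2 fun h' => hs (h.subset h')]

theorem eq_proj_iff {x y : List A} :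
    y = proj p q x ↔ (∀ s ∈ y, s = p ∨ s = q) ∧ y.Sublist x ∧ y.count p = x.count p ∧
      y.count q = x.count q := by
  constructor
  · rintro rfl
    exact ⟨fun s hs => (mem_proj.1 hs).2, List.filter_sublist, count_proj_left ..,
      count_proj_right ..⟩
  · rintro ⟨hy, h, hp, hq⟩
    refine eq_of_sublist_of_count_eq ?_ (fun s hs => (mem_proj.1 hs).2)
      (hp.trans (count_proj_left ..).symm) (hq.trans (count_proj_right ..).symm)
    rw [← proj_eq_self hy]
    exact h.filter _

theorem eq_of_proj_eq [Nontrivial A] {x y : List A}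
    (h : ∀ p q, p ≠ q → proj p q x = proj p q y) : x = y := by
  induction x generalizing y with
  | nil =>
    refine (List.eq_nil_iff_forall_not_mem.2 fun s hs => ?_).symm
    obtain ⟨t, hts⟩ := exists_ne s
    have : s ∈ proj s t y := mem_proj.2 ⟨hs, .inl rfl⟩
    rw [← h s t hts.symm] at this
    exact List.not_mem_nil this
  | cons s x ih =>
    cases y with
    | nil =>
      obtain ⟨t, hts⟩ := exists_ne s
      have := h s t hts.symm
      rw [proj_cons_left] at this
      exact absurd this (List.cons_ne_nil _ _)
    | cons t y =>
      obtain rfl : s = t := by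
        by_contra hst
        have := h s t hst
        rw [proj_cons_left, proj_cons_right] at this
        exact hst (List.cons.inj this).1
      refine congrArg _ (ih fun p q hpq => ?_)
      have := h p q hpq
      by_cases hsp : s = p
      · rw [hsp, proj_cons_left, proj_cons_left] at this
        exact (List.cons.inj this).2
      by_cases hsq : s = q
      · rw [hsq, proj_cons_right, proj_cons_right] at this
        exact (List.cons.inj this).2
      rwa [proj_cons_of_ne hsp hsq, proj_cons_of_ne hsp hsq] at this

theorem exists_eq_append_cons_of_three_letters {W : List A}
    (hW : ∀ s ∈ W, s = p ∨ s = q ∨ s = r) (h : W.count r = 1) :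
    ∃ y z, W = y ++ r :: z ∧ (∀ s ∈ y, s = p ∨ s = q) ∧ ∀ s ∈ z, s = p ∨ s = q := by
  obtain ⟨y, z, rfl, hy, hz⟩ := exists_eq_append_cons_of_count_eq_one h
  refine ⟨y, z, rfl, fun s hs => ?_, fun s hs => ?_⟩
  · exact (or_assoc.2 (hW s (by simp [hs]))).resolve_right fun e => hy (e ▸ hs)
  · exact (or_assoc.2 (hW s (by simp [hs]))).resolve_right fun e => hz (e ▸ hs)

theorem proj_append_cons (hrp : r ≠ p) (hrq : r ≠ q) {x y : List A}
    (hx : ∀ s ∈ x, s = p ∨ s = q) (hy : ∀ s ∈ y, s = p ∨ s = q) :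
    proj p q (x ++ r :: y) = x ++ y := by
  rw [proj_append, proj_cons_of_ne hrp hrq, proj_eq_self hx, proj_eq_self hy]

theorem eq_append_singleton_iff (hrp : r ≠ p) (hrq : r ≠ q) {x U : List A} :
    ((∀ s ∈ x, s = p ∨ s = q) ∧ U = x ++ [r]) ↔ (∀ s ∈ U, s = p ∨ s = q ∨ s = r) ∧
      U.count r = 1 ∧ ¬ [r, p].Sublist U ∧ ¬ [r, q].Sublist U ∧ x = proj p q U := by
  constructor
  · rintro ⟨hx, rfl⟩
    have hr : r ∉ x := fun h => (hx r h).elim hrp hrq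
    refine ⟨?_, ?_, ?_, ?_, ?_⟩
    · intro s hs
      rw [List.mem_append, List.mem_singleton] at hs
      exact or_assoc.1 (hs.imp_left (hx s))
    · simp [List.count_eq_zero.2 hr]
    · simp [pair_sublist_append_cons_iff hr]
    · simp [pair_sublist_append_cons_iff hr]
    · rw [proj_append_cons hrp hrq hx (by simp), List.append_nil]
  · rintro ⟨hU, hr, hp, hq, rfl⟩
    refine ⟨fun s hs => (mem_proj.1 hs).2, ?_⟩
    obtain ⟨y, z, rfl, hy, hz⟩ := exists_eq_append_cons_of_three_letters hU hr
    have hry : r ∉ y := fun h => (hy r h).elim hrp hrq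
    rw [pair_sublist_append_cons_iff hry] at hp
    rw [pair_sublist_append_cons_iff hry] at hq
    obtain rfl : z = [] := List.eq_nil_iff_forall_not_mem.2 fun s hs =>
      (hz s hs).elim (fun e => hp (e ▸ hs)) (fun e => hq (e ▸ hs))
    rw [proj_append_cons hrp hrq hy (by simp), List.append_nil]

theorem eq_cons_iff (hrp : r ≠ p) (hrq : r ≠ q) {x U : List A} :
    ((∀ s ∈ x, s = p ∨ s = q) ∧ U = r :: x) ↔ (∀ s ∈ U, s = p ∨ s = q ∨ s = r) ∧
      U.count r = 1 ∧ ¬ [p, r].Sublist U ∧ ¬ [q, r].Sublist U ∧ x = proj p q U := by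
  have := eq_append_singleton_iff hrp hrq (x := x.reverse) (U := U.reverse)
  rw [← List.reverse_sublist (l₁ := [r, p]), ← List.reverse_sublist (l₁ := [r, q]), proj,
    List.filter_reverse] at this
  simpa [proj, List.reverse_eq_iff, -List.reverse_sublist] using this

/-- The third letter `r` marks the place in `W` where `x` ends and `y` begins. -/
theorem eq_append_iff_of_two_letters (hrp : r ≠ p) (hrq : r ≠ q) {x y z : List A}
    (hx : ∀ s ∈ x, s = p ∨ s = q) (hy : ∀ s ∈ y, s = p ∨ s = q) :
    z = x ++ y ↔ ∃ W, (∀ s ∈ W, s = p ∨ s = q ∨ s = r) ∧ W.count r = 1 ∧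
      (x ++ [r]).Sublist W ∧ (r :: y).Sublist W ∧ x.count p + y.count p = W.count p ∧
      x.count q + y.count q = W.count q ∧ z = proj p q W := by
  have hrx : r ∉ x := fun h => (hx r h).elim hrp hrq
  have hry : r ∉ y := fun h => (hy r h).elim hrp hrq
  constructor
  · rintro rfl
    refine ⟨x ++ r :: y, ?_, ?_, ?_, List.sublist_append_right _ _, ?_, ?_, ?_⟩
    · intro s hs
      rw [List.mem_append, List.mem_cons] at hs
      rcases hs with hs | hs | hs
      · exact or_assoc.1 (.inl (hx s hs))
      · exact .inr (.inr hs)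
      · exact or_assoc.1 (.inl (hy s hs))
    · simp [List.count_eq_zero.2 hrx, List.count_eq_zero.2 hry]
    · exact (List.Sublist.refl x).append ((List.nil_sublist y).cons_cons r)
    · simp [hrp]
    · simp [hrq]
    · exact (proj_append_cons hrp hrq hx hy).symm
  · rintro ⟨W, hW, hr, hxW, hyW, hp, hq, rfl⟩
    obtain ⟨x', y', rfl, hx', hy'⟩ := exists_eq_append_cons_of_three_letters hW hr
    have hrx' : r ∉ x' := fun h => (hx' r h).elim hrp hrq
    have hry' : r ∉ y' := fun h => (hy' r h).elim hrp hrq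
    have hx_le : x.Sublist x' := (sublist_of_append_cons_sublist hrx hrx'
      (by rw [List.count_nil, List.count_eq_zero.2 hry']) hxW).1
    have hy_le : y.Sublist y' := (sublist_of_append_cons_sublist (x := []) List.not_mem_nil hrx'
      (by rw [List.count_eq_zero.2 hry, List.count_eq_zero.2 hry']) hyW).2
    rw [proj_append_cons hrp hrq hx' hy']
    refine (eq_of_sublist_of_count_eq (hx_le.append hy_le)
      (fun s hs => (List.mem_append.1 hs).elim (hx' s) (hy' s)) ?_ ?_).symm
    · simpa [hrp] using hp
    · simpa [hrq] using hq

end Projection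

section Powers

variable {A : Type*} {p q : A}

theorem exists_eq_flatten_replicate_of_append_comm (hpq : p ≠ q) {w : List A}
    (h : [p, q] ++ w = w ++ [p, q]) : ∃ n, w = (List.replicate n [p, q]).flatten := by
  match w with
  | [] => exact ⟨0, rfl⟩
  | [s] =>
    simp only [List.cons_append, List.nil_append, List.cons.injEq] at h
    exact absurd h.2.1.symm hpq
  | s :: t :: w =>
    simp only [List.cons_append, List.nil_append, List.cons.injEq] at h
    obtain ⟨rfl, rfl, h⟩ := h
    obtain ⟨n, rfl⟩ := exists_eq_flatten_replicate_of_append_comm hpq (w := w) h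
    exact ⟨n + 1, rfl⟩

theorem append_flatten_replicate_comm (u : List A) (n : ℕ) :
    u ++ (List.replicate n u).flatten = (List.replicate n u).flatten ++ u := by
  induction n with
  | zero => simp
  | succ n ih => rw [List.replicate_succ, List.flatten_cons, List.append_assoc, ← ih]

end Powers

/-- An alphabet with more than one letter in which every two letters avoid a third one, that is,
with at least three letters. -/
class HasThirdLetter (A : Type*) : Prop extends Nontrivial A where
  exists_third : ∀ p q : A, ∃ r, r ≠ p ∧ r ≠ q

namespace SigDef

variable {A : Type*} [Finite A] {p q r : A} {ι : Type} {i : ℕ}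

theorem eq_proj [DecidableEq A] (hpq : p ≠ q) (x y : ι) :
    WordDef A (i + 1) fun v => v y = proj p q (v x) := by
  simp only [eq_proj_iff]
  exact .and (.forall_mem _ _) (.and (.sublist _ _) (.and (.count_eq hpq _ _)
    (.count_eq hpq.symm _ _)))

theorem eq_append_singleton (hpq : p ≠ q) (hrp : r ≠ p) (hrq : r ≠ q) (x y : ι) :
    WordDef A (i + 1) fun v => (∀ s ∈ v x, s = p ∨ s = q) ∧ v y = v x ++ [r] := by
  classical
  simp only [eq_append_singleton_iff hrp hrq]
  exact .and (.forall_mem _ _) (.and (.count_eq_one _ _) (.and (.const_not_sublist _ _)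
    (.and (.const_not_sublist _ _) (.eq_proj hpq _ _))))

theorem eq_cons (hpq : p ≠ q) (hrp : r ≠ p) (hrq : r ≠ q) (x y : ι) :
    WordDef A (i + 1) fun v => (∀ s ∈ v x, s = p ∨ s = q) ∧ v y = r :: v x := by
  classical
  simp only [eq_cons_iff hrp hrq]
  exact .and (.forall_mem _ _) (.and (.count_eq_one _ _) (.and (.const_not_sublist _ _)
    (.and (.const_not_sublist _ _) (.eq_proj hpq _ _))))

theorem eq_append_of_two_letters (hpq : p ≠ q) (hrp : r ≠ p) (hrq : r ≠ q) (x y z : ι) :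
    WordDef A (i + 1) fun v => (∀ s ∈ v x, s = p ∨ s = q) ∧ (∀ s ∈ v y, s = p ∨ s = q) ∧
      v z = v x ++ v y := by
  classical
  have h : WordDef A (i + 1) fun v => ∃ U V W : List A,
      ((∀ s ∈ v x, s = p ∨ s = q) ∧ U = v x ++ [r]) ∧
      ((∀ s ∈ v y, s = p ∨ s = q) ∧ V = r :: v y) ∧
      (∀ s ∈ W, s = p ∨ s = q ∨ s = r) ∧ W.count r = 1 ∧ U.Sublist W ∧ V.Sublist W ∧
      (v x).count p + (v y).count p = W.count p ∧ (v x).count q + (v y).count q = W.count q ∧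
      v z = proj p q W :=
    .ex (.ex (.ex (.and (.eq_append_singleton hpq hrp hrq _ _) (.and (.eq_cons hpq hrp hrq _ _)
      (.and (.forall_mem _ _) (.and (.count_eq_one _ _) (.and (.sublist _ _) (.and (.sublist _ _)
      (.and (.count_add hpq _ _ _) (.and (.count_add hpq.symm _ _ _) (.eq_proj hpq _ _)))))))))))
  refine h.congr fun v => ?_
  constructor
  · rintro ⟨hx, hy, h⟩
    obtain ⟨W, hW⟩ := (eq_append_iff_of_two_letters hrp hrq hx hy).1 h
    exact ⟨_, _, W, ⟨hx, rfl⟩, ⟨hy, rfl⟩, hW⟩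
  · rintro ⟨_, _, W, ⟨hx, rfl⟩, ⟨hy, rfl⟩, hW⟩
    exact ⟨hx, hy, (eq_append_iff_of_two_letters hrp hrq hx hy).2 ⟨W, hW⟩⟩

variable [HasThirdLetter A]

theorem eq_append (x y z : ι) : WordDef A (i + 1) fun v => v z = v x ++ v y := by
  classical
  have h : WordDef A (i + 1) fun v => ∀ p q : A, p = q ∨ ∃ X Y Z : List A,
      X = proj p q (v x) ∧ Y = proj p q (v y) ∧ Z = proj p q (v z) ∧
      (∀ s ∈ X, s = p ∨ s = q) ∧ (∀ s ∈ Y, s = p ∨ s = q) ∧ Z = X ++ Y := by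
    refine .forall_finite fun p => .forall_finite fun q => ?_
    by_cases hpq : p = q
    · exact (SigDef.prop True).congr fun v => by simp [hpq]
    · obtain ⟨r, hrp, hrq⟩ := HasThirdLetter.exists_third p q
      exact .or (.prop _) (.ex (.ex (.ex (.and (.eq_proj hpq _ _) (.and (.eq_proj hpq _ _)
        (.and (.eq_proj hpq _ _) (.eq_append_of_two_letters hpq hrp hrq _ _ _)))))))
  refine h.congr fun v => ?_
  constructor
  · intro h p q
    exact .inr ⟨_, _, _, rfl, rfl, rfl, fun s hs => (mem_proj.1 hs).2,
      fun s hs => (mem_proj.1 hs).2, by rw [h, proj_append]⟩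
  · intro h
    refine eq_of_proj_eq fun p q hpq => ?_
    obtain ⟨_, _, _, rfl, rfl, rfl, -, -, e⟩ := (h p q).resolve_left hpq
    rw [e, proj_append]

theorem eq_flatten_replicate (hpq : p ≠ q) (x : ι) :
    WordDef A (i + 1) fun v => ∃ n, v x = (List.replicate n [p, q]).flatten := by
  have h : WordDef A (i + 1) fun v => ∃ u w : List A, u = [p, q] ∧ w = u ++ v x ∧ w = v x ++ u :=
    .ex (.ex (.and (.eq_const _ _) (.and (.eq_append _ _ _) (.eq_append _ _ _))))
  refine h.congr fun v => ?_
  constructor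
  · rintro ⟨n, h⟩
    exact ⟨_, _, rfl, rfl, by rw [h, append_flatten_replicate_comm]⟩
  · rintro ⟨_, _, rfl, rfl, h⟩
    exact exists_eq_flatten_replicate_of_append_comm hpq h

theorem count_eq_count [DecidableEq A] (hpq : p ≠ q) (x y : ι) :
    WordDef A (i + 1) fun v => (v x).count p = (v y).count q := by
  have h : WordDef A (i + 1) fun v => ∃ w : List A,
      (∃ n, w = (List.replicate n [p, q]).flatten) ∧
      (v x).count p = w.count p ∧ (v y).count q = w.count q :=
    .ex (.and (.eq_flatten_replicate hpq _) (.and (.count_eq hpq _ _) (.count_eq hpq.symm _ _)))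
  refine h.congr fun v => ?_
  have count_flatten (n : ℕ) : (List.replicate n [p, q]).flatten.count p = n ∧
      (List.replicate n [p, q]).flatten.count q = n := by
    simp [List.count_flatten, hpq, hpq.symm]
  constructor
  · intro h
    refine ⟨_, ⟨(v x).count p, rfl⟩, ?_⟩
    rw [(count_flatten _).1, (count_flatten _).2]
    exact ⟨rfl, h.symm⟩
  · rintro ⟨_, ⟨n, rfl⟩, hx, hy⟩
    rw [hx, hy, (count_flatten n).1, (count_flatten n).2]

end SigDef

/-! ### Vectors of natural numbers -/

section Vectors

variable {A : Type*} {a b c : A}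

theorem replicate_append_cons_sublist [DecidableEq A] (hab : a ≠ b) {n m : ℕ} {x y : List A}
    (hc : x.count b = y.count b)
    (h : (List.replicate n a ++ b :: x).Sublist (List.replicate m a ++ b :: y)) :
    n ≤ m ∧ x.Sublist y := by
  have hb (k : ℕ) : b ∉ List.replicate k a := fun h => hab (List.eq_of_mem_replicate h).symm
  simpa only [List.replicate_sublist_replicate] using
    sublist_of_append_cons_sublist (hb n) (hb m) hc h

theorem replicate_append_cons_inj (hab : a ≠ b) {n m : ℕ} {x y : List A}
    (h : List.replicate n a ++ b :: x = List.replicate m a ++ b :: y) : n = m ∧ x = y := by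
  classical
  have hc : x.count b = y.count b := by
    simpa [List.count_replicate, hab] using congrArg (List.count b) h
  obtain ⟨hnm, hxy⟩ := replicate_append_cons_sublist hab hc (by rw [h])
  obtain ⟨hmn, hyx⟩ := replicate_append_cons_sublist hab hc.symm (by rw [h])
  exact ⟨hnm.antisymm hmn, hxy.antisymm hyx⟩

theorem eq_zero_of_append_replicate_eq (hab : a ≠ b) {w : List A} {m : ℕ}
    (h : w ++ List.replicate m a = [] ∨ ∃ u t, t = [b] ∧ w ++ List.replicate m a = u ++ t) :
    m = 0 := by
  cases m with
  | zero => rfl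
  | succ m =>
    rw [List.replicate_succ', ← List.append_assoc] at h
    rcases h with h | ⟨u, _, rfl, h⟩
    · simp at h
    · exact absurd (List.singleton_inj.1 (List.append_inj_right' h rfl)) hab

/-- The word `a^n₁ b a^n₂ b ⋯ a^nₖ b` that represents the vector `[n₁, …, nₖ]`. -/
def enc (a b : A) (l : List ℕ) : List A :=
  l.flatMap fun n => List.replicate n a ++ [b]

theorem enc_cons (a b : A) (n : ℕ) (l : List ℕ) :
    enc a b (n :: l) = List.replicate n a ++ b :: enc a b l := by
  simp [enc]

theorem enc_append (a b : A) (l l' : List ℕ) : enc a b (l ++ l') = enc a b l ++ enc a b l' :=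
  List.flatMap_append

theorem enc_injective (hab : a ≠ b) : Function.Injective (enc a b) := by
  intro l l' h
  induction l generalizing l' with
  | nil => cases l' with
    | nil => rfl
    | cons m l' => simp [enc] at h
  | cons n l ih => cases l' with
    | nil => simp [enc] at h
    | cons m l' =>
      rw [enc_cons, enc_cons] at h
      obtain ⟨rfl, hl⟩ := replicate_append_cons_inj hab h
      rw [ih hl]

theorem mem_enc {s : A} {l : List ℕ} (h : s ∈ enc a b l) : s = a ∨ s = b := by
  simp only [enc, List.mem_flatMap, List.mem_append, List.mem_replicate, List.mem_singleton] at h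
  tauto

theorem exists_eq_enc_append {w : List A} (h : ∀ s ∈ w, s = a ∨ s = b) :
    ∃ l m, w = enc a b l ++ List.replicate m a := by
  induction w with
  | nil => exact ⟨[], 0, rfl⟩
  | cons s w ih =>
    obtain ⟨hs, hw⟩ := List.forall_mem_cons.1 h
    obtain ⟨l, m, rfl⟩ := ih hw
    rcases hs with rfl | rfl
    · cases l with
      | nil => exact ⟨[], m + 1, rfl⟩
      | cons n l => exact ⟨(n + 1) :: l, m, rfl⟩
    · exact ⟨0 :: l, m, rfl⟩

theorem exists_eq_enc_iff (hab : a ≠ b) {w : List A} : (∃ l, w = enc a b l) ↔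
    (∀ s ∈ w, s = a ∨ s = b) ∧ (w = [] ∨ ∃ u t, t = [b] ∧ w = u ++ t) := by
  constructor
  · rintro ⟨l, rfl⟩
    refine ⟨fun s => mem_enc, ?_⟩
    induction l using List.reverseRecOn with
    | nil => exact .inl rfl
    | append_singleton l n _ =>
      exact .inr ⟨enc a b l ++ List.replicate n a, _, rfl, by simp [enc]⟩
  · rintro ⟨h, h'⟩
    obtain ⟨l, m, rfl⟩ := exists_eq_enc_append h
    exact ⟨l, by rw [eq_zero_of_append_replicate_eq hab h', List.replicate_zero, List.append_nil]⟩

/-- The word `a^x₁ c a^y₁ b ⋯ a^xₖ c a^yₖ b`, whose projection to `a` and `b` represents the sum of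
the vectors `[x₁, …, xₖ]` and `[y₁, …, yₖ]`. -/
def interleave (a b c : A) (l : List (ℕ × ℕ)) : List A :=
  l.flatMap fun z => List.replicate z.1 a ++ c :: (List.replicate z.2 a ++ [b])

theorem interleave_cons (a b c : A) (z : ℕ × ℕ) (l : List (ℕ × ℕ)) :
    interleave a b c (z :: l) = List.replicate z.1 a ++
      c :: (List.replicate z.2 a ++ b :: interleave a b c l) := by
  simp [interleave]

theorem mem_interleave {s : A} {l : List (ℕ × ℕ)} (h : s ∈ interleave a b c l) :
    s = a ∨ s = b ∨ s = c := by
  simp only [interleave, List.mem_flatMap, List.mem_append, List.mem_cons, List.mem_replicate,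
    List.not_mem_nil] at h
  tauto

theorem cons_interleave_eq_interleave_append (a b c : A) (l : List ℕ) :
    c :: interleave a c b (l.map fun n => (n, 0)) =
      interleave a b c (l.map fun n => (0, n)) ++ [c] := by
  induction l with
  | nil => rfl
  | cons n l ih => simp [interleave_cons, ← ih]

theorem length_interleave (a b c : A) (l : List (ℕ × ℕ)) :
    (interleave a b c l).length = (l.map fun z => z.1 + z.2).sum + 2 * l.length := by
  induction l with
  | nil => rfl
  | cons z l ih =>
    simp only [interleave_cons, List.length_append, List.length_replicate, List.length_cons, ih,
      List.map_cons, List.sum_cons]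
    omega

theorem interleave_sublist_of_forall₂_le (a b c : A) {l l' : List (ℕ × ℕ)}
    (h : List.Forall₂ (· ≤ ·) l l') : (interleave a b c l).Sublist (interleave a b c l') := by
  induction h with
  | nil => exact .refl _
  | cons hz _ ih =>
    rw [interleave_cons, interleave_cons]
    exact ((List.replicate_sublist_replicate a).2 hz.1).append (.cons_cons _
      (((List.replicate_sublist_replicate a).2 hz.2).append (.cons_cons _ ih)))

section Counting

variable [DecidableEq A]

theorem count_enc_right (hab : a ≠ b) (l : List ℕ) : (enc a b l).count b = l.length := by
  induction l with
  | nil => rfl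
  | cons n l ih => simp [enc_cons, ih, List.count_replicate, hab]

theorem count_enc_left (hab : a ≠ b) (l : List ℕ) : (enc a b l).count a = l.sum := by
  induction l with
  | nil => rfl
  | cons n l ih => simp [enc_cons, ih, hab.symm]

theorem count_left_interleave (hab : a ≠ b) (hac : a ≠ c) (l : List (ℕ × ℕ)) :
    (interleave a b c l).count a = (l.map fun z => z.1 + z.2).sum := by
  induction l with
  | nil => rfl
  | cons z l ih => simp [interleave_cons, hab.symm, hac.symm, ih, add_assoc]

theorem count_right_interleave (hab : a ≠ b) (hbc : b ≠ c) (l : List (ℕ × ℕ)) :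
    (interleave a b c l).count b = l.length := by
  induction l with
  | nil => rfl
  | cons z l ih => simp [interleave_cons, List.count_replicate, hab, hbc.symm, ih]

theorem count_middle_interleave (hac : a ≠ c) (hbc : b ≠ c) (l : List (ℕ × ℕ)) :
    (interleave a b c l).count c = l.length := by
  induction l with
  | nil => rfl
  | cons z l ih => simp [interleave_cons, List.count_replicate, hac, hbc, ih]

theorem exists_eq_interleave_append {n : ℕ} {w : List A}
    (hw : ∀ s ∈ w, s = a ∨ s = b ∨ s = c)
    (h : proj b c w = (List.replicate n [c, b]).flatten) :
    ∃ l m, w = interleave a b c l ++ List.replicate m a := by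
  have eq_replicate {x : List A} (hx : ∀ s ∈ x, s = a ∨ s = b ∨ s = c)
      (hx' : ∀ s ∈ x, ¬ decide (s = b ∨ s = c) = true) : x = List.replicate x.length a :=
    List.eq_replicate_length.2 fun s hs => (hx s hs).resolve_right (by simpa using hx' s hs)
  induction n generalizing w with
  | zero =>
    exact ⟨[], _, eq_replicate hw (List.filter_eq_nil_iff.1 h)⟩
  | succ n ih =>
    rw [List.replicate_succ, List.flatten_cons, List.cons_append, List.cons_append,
      List.nil_append] at h
    obtain ⟨x, w', rfl, hx, -, h⟩ := List.filter_eq_cons_iff.1 h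
    obtain ⟨y, w'', rfl, hy, -, h⟩ := List.filter_eq_cons_iff.1 h
    simp only [List.forall_mem_append, List.forall_mem_cons] at hw
    obtain ⟨l, m, rfl⟩ := ih hw.2.2.2.2 h
    refine ⟨(x.length, y.length) :: l, m, ?_⟩
    rw [eq_replicate hw.1 hx, eq_replicate hw.2.2.1 hy]
    simp [interleave_cons]

theorem proj_outer_interleave_cons (hac : a ≠ c) (hbc : b ≠ c) (x y : ℕ) (l : List (ℕ × ℕ)) :
    proj a b (interleave a b c ((x, y) :: l)) =
      List.replicate (x + y) a ++ b :: proj a b (interleave a b c l) := by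
  have hrep (n : ℕ) : proj a b (List.replicate n a) = List.replicate n a :=
    proj_eq_self fun s hs => .inl (List.eq_of_mem_replicate hs)
  rw [interleave_cons, proj_append, proj_cons_of_ne hac.symm hbc.symm, proj_append,
    proj_cons_right, hrep, hrep, ← List.append_assoc, List.replicate_append_replicate]

theorem proj_inner_interleave_cons (hab : a ≠ b) (hbc : b ≠ c) (x y : ℕ) (l : List (ℕ × ℕ)) :
    proj a c (interleave a b c ((x, y) :: l)) =
      List.replicate x a ++ c :: (List.replicate y a ++ proj a c (interleave a b c l)) := by
  have hrep (n : ℕ) : proj a c (List.replicate n a) = List.replicate n a :=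
    proj_eq_self fun s hs => .inl (List.eq_of_mem_replicate hs)
  rw [interleave_cons, proj_append, proj_cons_right, proj_append, proj_cons_of_ne hab.symm hbc,
    hrep, hrep]

theorem proj_interleave (hac : a ≠ c) (hbc : b ≠ c) (l : List (ℕ × ℕ)) :
    proj a b (interleave a b c l) = enc a b (l.map fun z => z.1 + z.2) := by
  induction l with
  | nil => rfl
  | cons z l ih => rw [proj_outer_interleave_cons hac hbc, ih, List.map_cons, enc_cons]

theorem proj_inner_interleave (hab : a ≠ b) (hbc : b ≠ c) (l : List ℕ) :
    proj a c (interleave a b c (l.map fun n => (n, 0))) = enc a c l := by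
  induction l with
  | nil => rfl
  | cons n l ih =>
    rw [List.map_cons, proj_inner_interleave_cons hab hbc, ih, enc_cons, List.replicate_zero,
      List.nil_append]

theorem proj_separators_interleave (hab : a ≠ b) (hac : a ≠ c) (l : List (ℕ × ℕ)) :
    proj b c (interleave a b c l) = (List.replicate l.length [c, b]).flatten := by
  have hrep (n : ℕ) : proj b c (List.replicate n a) = [] :=
    List.filter_eq_nil_iff.2 fun s hs => by simp [List.eq_of_mem_replicate hs, hab, hac]
  induction l with
  | nil => rfl
  | cons z l ih =>
    rw [interleave_cons, proj_append, proj_cons_right, proj_append, proj_cons_left, hrep, hrep, ih,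
      List.length_cons, List.replicate_succ, List.flatten_cons]
    rfl

theorem exists_eq_interleave_iff (hab : a ≠ b) (hac : a ≠ c) {w : List A} :
    (∃ l, w = interleave a b c l) ↔ (∀ s ∈ w, s = a ∨ s = b ∨ s = c) ∧
      (∃ n, proj b c w = (List.replicate n [c, b]).flatten) ∧
      (w = [] ∨ ∃ u t, t = [b] ∧ w = u ++ t) := by
  constructor
  · rintro ⟨l, rfl⟩
    refine ⟨fun s => mem_interleave, ⟨_, proj_separators_interleave hab hac l⟩, ?_⟩
    induction l using List.reverseRecOn with
    | nil => exact .inl rfl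
    | append_singleton l z _ =>
      exact .inr ⟨interleave a b c l ++ List.replicate z.1 a ++ c :: List.replicate z.2 a, _, rfl,
        by simp [interleave]⟩
  · rintro ⟨hw, ⟨n, hn⟩, h⟩
    obtain ⟨l, m, rfl⟩ := exists_eq_interleave_append hw hn
    exact ⟨l, by rw [eq_zero_of_append_replicate_eq hab h, List.replicate_zero, List.append_nil]⟩

/-- In the first word each `b` is directly to the left of the corresponding `c`, up to letters `a`,
and in the second one to the right; as the projections agree, no letter `a` comes between. -/
theorem eq_map_of_proj_interleave_eq (hab : a ≠ b) (hac : a ≠ c) (hbc : b ≠ c) {v : List ℕ}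
    {l l' : List (ℕ × ℕ)} (hl : proj a b (interleave a c b l) = enc a b v)
    (hl' : proj a b (interleave a b c l') = enc a b v)
    (h : proj a c (interleave a c b l) = proj a c (interleave a b c l')) :
    l = v.map (fun n => (n, 0)) ∧ l' = v.map fun n => (n, 0) := by
  induction v generalizing l l' with
  | nil =>
    rcases l with - | ⟨⟨x, y⟩, l⟩
    · rcases l' with - | ⟨⟨x', y'⟩, l'⟩
      · exact ⟨rfl, rfl⟩
      · simp [proj_outer_interleave_cons hac hbc, enc] at hl'
    · simp [proj_inner_interleave_cons hac hbc.symm, enc] at hl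
  | cons n v ih =>
    rw [enc_cons] at hl hl'
    rcases l with - | ⟨⟨x, y⟩, l⟩
    · simp [proj, interleave] at hl
    rcases l' with - | ⟨⟨x', y'⟩, l'⟩
    · simp [proj, interleave] at hl'
    rw [proj_inner_interleave_cons hac hbc.symm] at hl
    rw [proj_outer_interleave_cons hac hbc] at hl'
    rw [proj_outer_interleave_cons hab hbc.symm, proj_inner_interleave_cons hab hbc] at h
    obtain ⟨rfl, hl_tail⟩ := replicate_append_cons_inj hab hl
    obtain ⟨hxy', hl_tail'⟩ := replicate_append_cons_inj hab hl'
    obtain ⟨rfl, h_tail⟩ := replicate_append_cons_inj hac h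
    obtain ⟨rfl, rfl⟩ : y = 0 ∧ y' = 0 := by omega
    obtain ⟨rfl, rfl⟩ := ih hl_tail hl_tail' h_tail
    exact ⟨rfl, rfl⟩

end Counting

theorem forall₂_le_of_interleave_sublist (hab : a ≠ b) (hac : a ≠ c) (hbc : b ≠ c)
    {l l' : List (ℕ × ℕ)} (h : l.length = l'.length)
    (h' : (interleave a b c l).Sublist (interleave a b c l')) : List.Forall₂ (· ≤ ·) l l' := by
  classical
  induction l generalizing l' with
  | nil => cases l' with
    | nil => exact .nil
    | cons z' l' => simp at h
  | cons z l ih => cases l' with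
    | nil => simp at h
    | cons z' l' =>
      have hlen := Nat.succ_injective h
      rw [interleave_cons, interleave_cons] at h'
      obtain ⟨h₁, h'⟩ := replicate_append_cons_sublist hac (by
        simp [List.count_replicate, hac, hbc, count_middle_interleave, hlen]) h'
      obtain ⟨h₂, h'⟩ := replicate_append_cons_sublist hab (by
        simp [count_right_interleave, hab, hbc, hlen]) h'
      exact .cons ⟨h₁, h₂⟩ (ih hlen h')

theorem eq_interleave_iff [DecidableEq A] (hab : a ≠ b) (hac : a ≠ c) (hbc : b ≠ c)
    {l : List (ℕ × ℕ)} {w : List A} : w = interleave a b c l ↔ (∃ l', w = interleave a b c l') ∧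
      l.length = w.count b ∧ (l.map fun z => z.1 + z.2).sum = w.count a ∧
      (interleave a b c (l.map fun z => (z.1, 0))).Sublist w ∧
      (interleave a b c (l.map fun z => (0, z.2))).Sublist w := by
  constructor
  · rintro rfl
    refine ⟨⟨_, rfl⟩, (count_right_interleave hab hbc l).symm,
      (count_left_interleave hab hac l).symm, interleave_sublist_of_forall₂_le a b c ?_,
      interleave_sublist_of_forall₂_le a b c ?_⟩ <;>
    · rw [List.forall₂_map_left_iff, List.forall₂_same]
      simp [Prod.le_def]
  · rintro ⟨⟨l', rfl⟩, hlen, hsum, h₁, h₂⟩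
    rw [count_right_interleave hab hbc] at hlen
    rw [count_left_interleave hab hac] at hsum
    replace h₁ := forall₂_le_of_interleave_sublist hab hac hbc (by simpa using hlen) h₁
    replace h₂ := forall₂_le_of_interleave_sublist hab hac hbc (by simpa using hlen) h₂
    rw [List.forall₂_map_left_iff] at h₁ h₂
    rw [List.forall₂_iff_zip] at h₁ h₂
    have h : List.Forall₂ (· ≤ ·) l l' :=
      List.forall₂_iff_zip.2 ⟨hlen, fun hz => ⟨(h₁.2 hz).1, (h₂.2 hz).2⟩⟩
    exact ((interleave_sublist_of_forall₂_le a b c h).eq_of_length (by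
      rw [length_interleave, length_interleave, hlen, hsum])).symm

end Vectors

namespace SigDef

variable {A : Type*} [Finite A] [HasThirdLetter A] {a b c : A} {ι : Type} {i : ℕ}

theorem exists_eq_enc (hab : a ≠ b) (x : ι) : WordDef A (i + 1) fun v => ∃ l, v x = enc a b l := by
  simp only [exists_eq_enc_iff hab]
  exact .and (.forall_mem _ _) (.or (.eq_const _ _)
    (.ex (.ex (.and (.eq_const _ _) (.eq_append _ _ _)))))

theorem exists_eq_interleave (hab : a ≠ b) (hac : a ≠ c) (hbc : b ≠ c) (x : ι) :
    WordDef A (i + 1) fun v => ∃ l, v x = interleave a b c l := by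
  classical
  have h : WordDef A (i + 1) fun v => (∀ s ∈ v x, s = a ∨ s = b ∨ s = c) ∧
      (∃ w : List A, w = proj b c (v x) ∧ ∃ n, w = (List.replicate n [c, b]).flatten) ∧
      (v x = [] ∨ ∃ u t : List A, t = [b] ∧ v x = u ++ t) :=
    .and (.forall_mem _ _) (.and (.ex (.and (.eq_proj hbc _ _) (.eq_flatten_replicate hbc.symm _)))
      (.or (.eq_const _ _) (.ex (.ex (.and (.eq_const _ _) (.eq_append _ _ _))))))
  refine h.congr fun v => ?_
  rw [exists_eq_interleave_iff hab hac, exists_eq_left]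

theorem enc_interleave (hab : a ≠ b) (hac : a ≠ c) (hbc : b ≠ c) (x y z : ι) :
    WordDef A (i + 1) fun v => ∃ l : List ℕ, v x = enc a b l ∧
      v y = interleave a c b (l.map fun n => (n, 0)) ∧
      v z = interleave a b c (l.map fun n => (n, 0)) := by
  classical
  have h : WordDef A (i + 1) fun v => ∃ w : List A, (∃ l, v x = enc a b l) ∧
      (∃ l, v y = interleave a c b l) ∧ (∃ l, v z = interleave a b c l) ∧
      v x = proj a b (v y) ∧ v x = proj a b (v z) ∧ w = proj a c (v y) ∧ w = proj a c (v z) :=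
    .ex (.and (.exists_eq_enc hab _) (.and (.exists_eq_interleave hac hab hbc.symm _)
      (.and (.exists_eq_interleave hab hac hbc _) (.and (.eq_proj hab _ _)
      (.and (.eq_proj hab _ _) (.and (.eq_proj hac _ _) (.eq_proj hac _ _)))))))
  refine h.congr fun v => ?_
  constructor
  · rintro ⟨l, hx, hy, hz⟩
    rw [hx, hy, hz]
    refine ⟨enc a c l, ⟨_, rfl⟩, ⟨_, rfl⟩, ⟨_, rfl⟩, (proj_inner_interleave hac hbc.symm l).symm,
      ?_, ?_, (proj_inner_interleave hab hbc l).symm⟩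
    · simp [proj_interleave hac hbc, Function.comp_def]
    · simp [proj_interleave hab hbc.symm, Function.comp_def]
  · rintro ⟨w, ⟨l, hx⟩, ⟨ly, hy⟩, ⟨lz, hz⟩, hxy, hxz, hwy, hwz⟩
    rw [hx, hy] at hxy
    rw [hx, hz] at hxz
    rw [hwy, hy, hz] at hwz
    obtain ⟨rfl, rfl⟩ := eq_map_of_proj_interleave_eq hab hac hbc hxy.symm hxz.symm hwz
    exact ⟨l, hx, hy, hz⟩

theorem enc_interleave_snd (hab : a ≠ b) (hac : a ≠ c) (hbc : b ≠ c) (x y : ι) :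
    WordDef A (i + 1) fun v => ∃ l : List ℕ, v x = enc a b l ∧
      v y = interleave a b c (l.map fun n => (0, n)) := by
  have h : WordDef A (i + 1) fun v => ∃ t w w' u : List A, (∃ l : List ℕ, v x = enc a b l ∧
      w = interleave a c b (l.map fun n => (n, 0)) ∧
      w' = interleave a b c (l.map fun n => (n, 0))) ∧ t = [c] ∧ u = t ++ w ∧ u = v y ++ t :=
    .ex (.ex (.ex (.ex (.and (.enc_interleave hab hac hbc _ _ _) (.and (.eq_const _ _)
      (.and (.eq_append _ _ _) (.eq_append _ _ _)))))))
  refine h.congr fun v => ?_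
  constructor
  · rintro ⟨l, hx, hy⟩
    exact ⟨_, _, _, _, ⟨l, hx, rfl, rfl⟩, rfl, rfl,
      by rw [hy]; exact cons_interleave_eq_interleave_append a b c l⟩
  · rintro ⟨_, _, _, _, ⟨l, hx, rfl, rfl⟩, rfl, rfl, h⟩
    exact ⟨l, hx, (List.append_cancel_right
      ((cons_interleave_eq_interleave_append a b c l).symm.trans h)).symm⟩

theorem enc_add (hab : a ≠ b) (hac : a ≠ c) (hbc : b ≠ c) (x y z : ι) :
    WordDef A (i + 1) fun v => ∃ l : List (ℕ × ℕ), v x = enc a b (l.map Prod.fst) ∧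
      v y = enc a b (l.map Prod.snd) ∧ v z = enc a b (l.map fun n => n.1 + n.2) := by
  classical
  have h : WordDef A (i + 1) fun v => ∃ s t u w : List A,
      (∃ l : List ℕ, v x = enc a b l ∧ s = interleave a c b (l.map fun n => (n, 0)) ∧
        t = interleave a b c (l.map fun n => (n, 0))) ∧
      (∃ l : List ℕ, v y = enc a b l ∧ u = interleave a b c (l.map fun n => (0, n))) ∧
      (v x).count b = (v y).count b ∧ (∃ l, w = interleave a b c l) ∧
      (v x).count b = w.count b ∧ (v x).count a + (v y).count a = w.count a ∧
      t.Sublist w ∧ u.Sublist w ∧ v z = proj a b w :=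
    .ex (.ex (.ex (.ex (.and (.enc_interleave hab hac hbc _ _ _)
      (.and (.enc_interleave_snd hab hac hbc _ _) (.and (.count_eq hab.symm _ _)
      (.and (.exists_eq_interleave hab hac hbc _) (.and (.count_eq hab.symm _ _)
      (.and (.count_add hab _ _ _) (.and (.sublist _ _) (.and (.sublist _ _)
      (.eq_proj hab _ _))))))))))))
  refine h.congr fun v => ?_
  constructor
  · rintro ⟨l, hx, hy, hz⟩
    obtain ⟨hl, hlen, hsum, hfst, hsnd⟩ := (eq_interleave_iff hab hac hbc (l := l)).1 rfl
    refine ⟨_, _, _, _, ⟨_, hx, rfl, rfl⟩, ⟨_, hy, rfl⟩, ?_, hl, ?_, ?_, ?_, ?_,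
      hz.trans (proj_interleave hac hbc l).symm⟩
    · rw [hx, hy, count_enc_right hab, count_enc_right hab, List.length_map, List.length_map]
    · rw [hx, count_enc_right hab, List.length_map, hlen]
    · rw [hx, hy, count_enc_left hab, count_enc_left hab, ← hsum, List.sum_map_add]
    · rwa [List.map_map]
    · rwa [List.map_map]
  · rintro ⟨_, _, _, w, ⟨lx, hx, rfl, rfl⟩, ⟨ly, hy, rfl⟩, hlen, hw, hwb, hwa, hfst, hsnd, hz⟩
    rw [hx, hy, count_enc_right hab, count_enc_right hab] at hlen
    rw [hx, count_enc_right hab] at hwb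
    rw [hx, hy, count_enc_left hab, count_enc_left hab] at hwa
    obtain ⟨l, rfl, rfl⟩ : ∃ l : List (ℕ × ℕ), lx = l.map Prod.fst ∧ ly = l.map Prod.snd :=
      ⟨lx.zip ly, (List.map_fst_zip hlen.le).symm, (List.map_snd_zip hlen.ge).symm⟩
    rw [List.map_map] at hfst hsnd
    obtain rfl := (eq_interleave_iff hab hac hbc (l := l)).2 ⟨hw, by simpa using hwb,
      List.sum_map_add.trans hwa, hfst, hsnd⟩
    exact ⟨l, hx, hy, hz.trans (proj_interleave hac hbc l)⟩

end SigDef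

/-! ### Pointwise definable relations between vectors -/

/-- The words `w x` represent vectors of the same length such that the numbers in each position
satisfy `R`. The vectors are given by the list `L` of these tuples of numbers. -/
def vecRel {A : Type*} {ι : Type} (a b : A) (R : (ι → ℕ) → Prop) (w : ι → List A) : Prop :=
  ∃ L : List (ι → ℕ), (∀ l ∈ L, R l) ∧ ∀ x, w x = enc a b (L.map fun l => l x)

/-- The relation `R` between natural numbers, applied in all positions of vectors, is definable
at level `i + 1`. -/
def VecDef {A : Type*} {ι : Type} (a b : A) (i : ℕ) (R : (ι → ℕ) → Prop) : Prop :=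
  WordDef A (i + 1) (vecRel a b R)

section PointwiseRelations

variable {A : Type*} {a b : A} {ι κ : Type}

theorem eq_of_map_eval_eq {α : Type*} [Nonempty ι] {L L' : List (ι → α)}
    (h : ∀ x, L.map (fun l => l x) = L'.map fun l => l x) : L = L' := by
  obtain ⟨x₀⟩ := ‹Nonempty ι›
  have hl : L.length = L'.length := by simpa using congrArg List.length (h x₀)
  refine List.ext_getElem hl fun n h₁ h₂ => funext fun x => ?_
  have := List.getElem_of_eq (h x) (by simpa using h₁ : n < (L.map fun l => l x).length)
  rwa [List.getElem_map, List.getElem_map] at this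

theorem forall₂_iff_exists_map {α β : Type*} {E : α → β → Prop} {X : List α} {Y : List β} :
    List.Forall₂ E X Y ↔ ∃ L : List (α × β), (∀ z ∈ L, E z.1 z.2) ∧ X = L.map Prod.fst ∧
      Y = L.map Prod.snd := by
  constructor
  · intro h
    exact ⟨X.zip Y, fun _ hz => (List.forall₂_iff_zip.1 h).2 hz,
      (List.map_fst_zip h.length_eq.le).symm, (List.map_snd_zip h.length_eq.ge).symm⟩
  · rintro ⟨L, hL, rfl, rfl⟩
    rw [List.forall₂_map_left_iff, List.forall₂_map_right_iff, List.forall₂_same]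
    exact hL

theorem vecRel_of_isEmpty [IsEmpty ι] (R : (ι → ℕ) → Prop) (w : ι → List A) : vecRel a b R w :=
  ⟨[], fun _ h => absurd h List.not_mem_nil, isEmptyElim⟩

theorem vecRel_exists_iff {P : (ι → ℕ) → (κ → ℕ) → Prop} {w : ι → List A} :
    vecRel a b (fun v => ∃ u, P v u) w ↔ ∃ u : κ → List A, vecRel a b
      (fun v : ι ⊕ κ → ℕ => P (fun x => v (.inl x)) fun y => v (.inr y)) (Sum.elim w u) := by
  constructor
  · rintro ⟨L, hL, h⟩
    choose! g hg using hL
    refine ⟨fun y => enc a b (L.map fun l => g l y), L.map fun l => Sum.elim l (g l), ?_, ?_⟩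
    · simpa using hg
    · rintro (x | y)
      · simp [h, Function.comp_def]
      · simp [Function.comp_def]
  · rintro ⟨u, L, hL, h⟩
    refine ⟨L.map fun l x => l (.inl x), List.forall_mem_map.2 fun l hl => ⟨_, hL l hl⟩,
      fun x => ?_⟩
    simpa [Function.comp_def] using h (.inl x)

theorem vecRel_sum_iff {E : (ι → ℕ) → (ι → ℕ) → Prop} {w : ι ⊕ ι → List A} :
    vecRel a b (fun v : ι ⊕ ι → ℕ => E (fun x => v (.inl x)) fun x => v (.inr x)) w ↔
    ∃ X Y : List (ι → ℕ), List.Forall₂ E X Y ∧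
      (∀ x, w (.inl x) = enc a b (X.map fun l => l x)) ∧
      ∀ x, w (.inr x) = enc a b (Y.map fun l => l x) := by
  constructor
  · rintro ⟨L, hL, h⟩
    refine ⟨L.map fun l x => l (.inl x), L.map fun l x => l (.inr x), ?_, ?_, ?_⟩
    · rwa [List.forall₂_map_left_iff, List.forall₂_map_right_iff, List.forall₂_same]
    · intro x
      simp [h, Function.comp_def]
    · intro x
      simp [h, Function.comp_def]
  · rintro ⟨_, _, hXY, h₁, h₂⟩
    obtain ⟨L, hL, rfl, rfl⟩ := forall₂_iff_exists_map.1 hXY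
    refine ⟨L.map fun z => Sum.elim z.1 z.2, ?_, ?_⟩
    · rw [List.forall_mem_map]
      exact hL
    rintro (x | x)
    · simp [h₁, Function.comp_def]
    · simp [h₂, Function.comp_def]

theorem enc_replicate_one (a b : A) (n : ℕ) :
    enc a b (List.replicate n 1) = (List.replicate n [a, b]).flatten := by
  induction n with
  | zero => rfl
  | succ n ih => simp [List.replicate_succ, ← ih, enc_cons]

variable [hab : Fact (a ≠ b)]

theorem vecRel_iff [Nonempty ι] {R : (ι → ℕ) → Prop} {w : ι → List A} {L : List (ι → ℕ)}
    (h : ∀ x, w x = enc a b (L.map fun l => l x)) : vecRel a b R w ↔ ∀ l ∈ L, R l := by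
  constructor
  · rintro ⟨L', hL', h'⟩
    rwa [eq_of_map_eval_eq fun x => enc_injective hab.out ((h x).symm.trans (h' x))]
  · exact fun hL => ⟨L, hL, h⟩

theorem vecRel_and_iff {R S : (ι → ℕ) → Prop} {w : ι → List A} :
    vecRel a b (fun v => R v ∧ S v) w ↔ vecRel a b R w ∧ vecRel a b S w := by
  rcases isEmpty_or_nonempty ι with hι | hι
  · simp only [vecRel_of_isEmpty, and_self]
  constructor
  · rintro ⟨L, hL, h⟩
    exact ⟨⟨L, fun l hl => (hL l hl).1, h⟩, ⟨L, fun l hl => (hL l hl).2, h⟩⟩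
  · rintro ⟨⟨L, hL, h⟩, h'⟩
    rw [vecRel_iff h] at h' ⊢
    exact fun l hl => ⟨hL l hl, h' l hl⟩

theorem vecRel_comp_iff [Nonempty ι] {R : (ι → ℕ) → Prop} (f : ι → κ) {w : κ → List A} :
    vecRel a b (fun v => R (v ∘ f)) w ↔ vecRel a b (fun _ => True) w ∧ vecRel a b R (w ∘ f) := by
  have : Nonempty κ := ‹Nonempty ι›.map f
  have comp_eq {L : List (κ → ℕ)} (h : ∀ x, w x = enc a b (L.map fun l => l x)) (x : ι) :
      (w ∘ f) x = enc a b ((L.map (· ∘ f)).map fun l => l x) := by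
    simp [h, Function.comp_def]
  constructor
  · rintro ⟨L, hL, h⟩
    exact ⟨⟨L, fun _ _ => trivial, h⟩, L.map (· ∘ f), List.forall_mem_map.2 hL, comp_eq h⟩
  · rintro ⟨⟨L, -, h⟩, h'⟩
    rw [vecRel_iff h]
    exact List.forall_mem_map.1 ((vecRel_iff (comp_eq h)).1 h')

theorem vecRel_true_iff [DecidableEq A] {w : ι → List A} : vecRel a b (fun _ => True) w ↔
    (∀ x, ∃ l, w x = enc a b l) ∧ ∀ x y, (w x).count b = (w y).count b := by
  constructor
  · rintro ⟨L, -, h⟩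
    exact ⟨fun x => ⟨_, h x⟩, fun x y => by simp [h, count_enc_right hab.out]⟩
  · rintro ⟨h, h'⟩
    choose l hl using h
    rcases isEmpty_or_nonempty ι with hι | ⟨⟨x₀⟩⟩
    · exact vecRel_of_isEmpty _ _
    refine ⟨(List.range (l x₀).length).map fun t x => (l x).getD t 0, fun _ _ => trivial,
      fun x => ?_⟩
    have hx := h' x x₀
    rw [hl, hl, count_enc_right hab.out, count_enc_right hab.out] at hx
    rw [hl, List.map_map]
    refine congrArg _ (List.ext_getElem (by simp [hx]) fun n h₁ h₂ => ?_)
    simp [h₁]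

end PointwiseRelations

namespace VecDef

variable {A : Type*} {a b : A} {i : ℕ} {ι κ : Type}

theorem congr {R S : (ι → ℕ) → Prop} (h : VecDef a b i R) (e : ∀ v, S v ↔ R v) :
    VecDef a b i S := by
  rwa [show S = R from funext fun v => propext (e v)]

theorem succ {R : (ι → ℕ) → Prop} (h : VecDef a b i R) : VecDef a b (i + 1) R :=
  SigDef.succ h

theorem exists_fun [Finite κ] {P : (ι → ℕ) → (κ → ℕ) → Prop}
    (h : VecDef a b i fun v : ι ⊕ κ → ℕ => P (fun x => v (.inl x)) fun y => v (.inr y)) :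
    VecDef a b i fun v => ∃ u, P v u := by
  refine (SigDef.exists_fun (P := fun w u => vecRel a b (fun v : ι ⊕ κ → ℕ =>
    P (fun x => v (.inl x)) fun y => v (.inr y)) (Sum.elim w u)) ?_).congr
    fun w => vecRel_exists_iff
  refine SigDef.congr h fun w => Eq.to_iff (congrArg _ ?_)
  funext x
  cases x <;> rfl

variable [hab : Fact (a ≠ b)]

theorem and {R S : (ι → ℕ) → Prop} (hR : VecDef a b i R) (hS : VecDef a b i S) :
    VecDef a b i fun v => R v ∧ S v :=
  (SigDef.and hR hS).congr fun _ => vecRel_and_iff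

variable [Finite A] [HasThirdLetter A]

theorem true [Finite ι] : VecDef a b i fun _ : ι → ℕ => True := by
  classical
  refine SigDef.congr ?_ fun w => vecRel_true_iff
  exact .and (.forall_finite fun x => .exists_eq_enc hab.out x)
    (.forall_finite fun x => .forall_finite fun y => .count_eq hab.out.symm x y)

theorem prop [Finite ι] (p : Prop) : VecDef a b i fun _ : ι → ℕ => p := by
  by_cases hp : p
  · exact VecDef.true.congr fun _ => iff_true_intro hp
  · refine SigDef.congr (.forall_finite fun x => .eq_const [] x) fun w => ⟨?_, fun h => ?_⟩
    · rintro ⟨L, hL, h⟩ x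
      rw [h, List.eq_nil_iff_forall_not_mem.2 fun l hl => hp (hL l hl)]
      rfl
    · exact ⟨[], fun _ h => absurd h List.not_mem_nil, h⟩

theorem reindex [Finite κ] {R : (ι → ℕ) → Prop} (f : ι → κ) (h : VecDef a b i R) :
    VecDef a b i fun v : κ → ℕ => R (v ∘ f) := by
  rcases isEmpty_or_nonempty ι with hι | hι
  · exact (VecDef.prop (R isEmptyElim)).congr fun v =>
      Eq.to_iff (congrArg R (Subsingleton.elim _ _))
  · exact (SigDef.and VecDef.true (SigDef.reindex f h)).congr fun _ => vecRel_comp_iff f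

theorem ex [Finite ι] {P : (ι → ℕ) → ℕ → Prop}
    (h : VecDef a b i fun v : Option ι → ℕ => P (fun x => v (some x)) (v none)) :
    VecDef a b i fun v => ∃ n, P v n := by
  have h' := h.reindex (κ := ι ⊕ Unit) fun o => o.elim (.inr ()) .inl
  refine (exists_fun (κ := Unit) (P := fun v w => P v (w ())) h').congr fun v => ?_
  exact ⟨fun ⟨x, hx⟩ => ⟨fun _ => x, hx⟩, fun ⟨w, hw⟩ => ⟨_, hw⟩⟩

variable [Finite ι]

theorem forall_finite {β : Type*} [Finite β] {P : β → (ι → ℕ) → Prop}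
    (h : ∀ x, VecDef a b i (P x)) : VecDef a b i fun v => ∀ x, P x v := by
  classical
  have := Fintype.ofFinite β
  have forall_mem (s : Finset β) : VecDef a b i fun v => ∀ x ∈ s, P x v := by
    induction s using Finset.induction_on with
    | empty => exact VecDef.true.congr fun v => by simp
    | insert x s _ ih => exact ((h x).and ih).congr fun v => by simp
  exact (forall_mem Finset.univ).congr fun v => by simp

theorem add (x y z : ι) : VecDef a b i fun v : ι → ℕ => v x + v y = v z := by
  have : Nonempty ι := ⟨x⟩
  obtain ⟨c, hca, hcb⟩ := HasThirdLetter.exists_third a b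
  refine (SigDef.and (VecDef.true (a := a) (b := b))
    (SigDef.enc_add hab.out hca.symm hcb.symm x y z)).congr fun w => ?_
  constructor
  · rintro ⟨L, hL, h⟩
    refine ⟨⟨L, fun _ _ => trivial, h⟩, L.map fun l => (l x, l y), ?_⟩
    simp only [h, List.map_map, Function.comp_def, true_and]
    exact congrArg _ (List.map_congr_left fun l hl => (hL l hl).symm)
  · rintro ⟨⟨L, -, h⟩, l, hx, hy, hz⟩
    rw [vecRel_iff h]
    rw [h] at hx hy hz
    replace hx := enc_injective hab.out hx
    replace hy := enc_injective hab.out hy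
    replace hz := enc_injective hab.out hz
    obtain rfl : l = L.map fun l => (l x, l y) := by
      rw [← List.zip_map', hx, hy, ← List.unzip_fst, ← List.unzip_snd, List.zip_unzip]
    rw [List.map_map, List.map_inj_left] at hz
    exact fun l hl => (hz l hl).symm

theorem eq_zero (x : ι) : VecDef a b i fun v : ι → ℕ => v x = 0 :=
  (VecDef.add x x x).congr fun v => by omega

theorem eq_one (x : ι) : VecDef a b i fun v : ι → ℕ => v x = 1 := by
  have : Nonempty ι := ⟨x⟩
  refine (SigDef.and (VecDef.true (a := a) (b := b))
    (SigDef.eq_flatten_replicate hab.out x)).congr fun w => ?_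
  simp only [← enc_replicate_one]
  constructor
  · rintro ⟨L, hL, h⟩
    refine ⟨⟨L, fun _ _ => trivial, h⟩, L.length, (h x).trans (congrArg _ ?_)⟩
    exact List.eq_replicate_iff.2 ⟨L.length_map _, List.forall_mem_map.2 hL⟩
  · rintro ⟨⟨L, -, h⟩, n, h'⟩
    rw [h] at h'
    exact (vecRel_iff h).2
      (List.forall_mem_map.1 (List.eq_replicate_iff.1 (enc_injective hab.out h')).2)

theorem eq (x y : ι) : VecDef a b i fun v : ι → ℕ => v x = v y := by
  have h : VecDef a b i fun v : ι → ℕ => ∃ n, n = 0 ∧ v x + n = v y :=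
    .ex (.and (.eq_zero _) (.add _ _ _))
  exact h.congr fun v => by simp

theorem eq_succ (x y : ι) : VecDef a b i fun v : ι → ℕ => v y = v x + 1 := by
  have h : VecDef a b i fun v : ι → ℕ => ∃ n, n = 1 ∧ v x + n = v y :=
    .ex (.and (.eq_one _) (.add _ _ _))
  exact h.congr fun v => by simp [eq_comm]

theorem le (x y : ι) : VecDef a b i fun v : ι → ℕ => v x ≤ v y := by
  have h : VecDef a b i fun v : ι → ℕ => ∃ n, v x + n = v y := .ex (.add _ _ _)
  exact h.congr fun v => by simp only [le_iff_exists_add, eq_comm]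

theorem lt (x y : ι) : VecDef a b i fun v : ι → ℕ => v x < v y := by
  have h : VecDef a b i fun v : ι → ℕ => ∃ m, m = v x + 1 ∧ m ≤ v y :=
    .ex (.and (.eq_succ _ _) (.le _ _))
  exact h.congr fun v => by rw [exists_eq_left, Nat.succ_le_iff]

end VecDef

/-! ### Transitive closures -/

section Chains

open Relation List

variable {β : Type*} {E : β → β → Prop} {X Y : List β}

theorem reflTransGen_forall₂_of_forall₂ [Std.Refl E] (h : Forall₂ (ReflTransGen E) X Y) :
    ReflTransGen (Forall₂ E) X Y := by
  induction h with
  | nil => exact .refl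
  | @cons s t X Y h _ ih =>
    exact (h.lift (p := Forall₂ E) (· :: X) fun _ _ h => .cons h (forall₂_refl X)).trans
      (ih.lift (p := Forall₂ E) (t :: ·) fun _ _ h => .cons (refl t) h)

theorem forall₂_of_reflTransGen_forall₂ (h : ReflTransGen (Forall₂ E) X Y) :
    Forall₂ (ReflTransGen E) X Y := by
  induction h using ReflTransGen.head_induction_on with
  | refl => exact forall₂_refl Y
  | @head X Z h hZ ih =>
    clear hZ
    induction h generalizing Y with
    | nil => exact ih
    | cons h _ ih' =>
      obtain ⟨t, Y, hst, hY, rfl⟩ := forall₂_cons_left_iff.1 ih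
      exact .cons (hst.head h) (ih' hY)

theorem exists_prefix_of_append_eq_append {S S' : List β} (e : X ++ S' = S ++ Y)
    (hS : Forall₂ E S S') (h : X.length ≤ S'.length) : ∃ Z T T', Forall₂ E X Z ∧
      Forall₂ E T T' ∧ S = X ++ T ∧ S' = Z ++ T' := by
  obtain ⟨T, rfl⟩ : X <+: S :=
    prefix_of_prefix_length_le (l₃ := S ++ Y) ⟨S', e⟩ ⟨Y, rfl⟩ (h.trans hS.length_eq.ge)
  refine ⟨S'.take X.length, T, S'.drop X.length, ?_, ?_, rfl, (take_append_drop _ _).symm⟩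
  · simpa using forall₂_take X.length hS
  · simpa using forall₂_drop X.length hS

/-- A chain of lists `X = X₀, X₁, …, Xₖ = Y` is represented by the concatenations of
`X₀, …, Xₖ₋₁` and of `X₁, …, Xₖ`. -/
theorem reflTransGen_forall₂_iff (hXY : X.length = Y.length) : ReflTransGen (Forall₂ E) X Y ↔
    ∃ S S' : List β, X ++ S' = S ++ Y ∧ Forall₂ E S S' ∧ X.length ∣ S'.length := by
  constructor
  · intro h
    clear hXY
    induction h with
    | refl => exact ⟨[], [], by simp, .nil, by simp⟩
    | @tail Y Z h₁ h ih =>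
      obtain ⟨S, S', e, hS, hd⟩ := ih
      refine ⟨S ++ Y, S' ++ Z, ?_, rel_append hS h, ?_⟩
      · rw [← append_assoc, e]
      · rw [length_append, ← h.length_eq, ← (forall₂_of_reflTransGen_forall₂ h₁).length_eq]
        exact Nat.dvd_add_self_right.2 hd
  · rintro ⟨S, S', e, hS, k, hk⟩
    induction k generalizing X S S' with
    | zero =>
      obtain rfl : S' = [] := length_eq_zero_iff.1 hk
      cases hS
      rw [append_nil, nil_append] at e
      rw [e]
    | succ k ih =>
      obtain ⟨Z, T, T', hXZ, hT, rfl, rfl⟩ := exists_prefix_of_append_eq_append e hS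
        (by rw [hk]; exact Nat.le_mul_of_pos_right _ k.succ_pos)
      rw [append_assoc, append_cancel_left_eq] at e
      refine .head hXZ (ih (hXZ.length_eq.symm.trans hXY) _ _ e hT ?_)
      rw [length_append, ← hXZ.length_eq, Nat.mul_succ] at hk
      rw [← hXZ.length_eq]
      omega

theorem dvd_count_of_append_comm [DecidableEq β] {a b : β} (hab : a ≠ b) {n : ℕ} {D : List β}
    (h : a :: replicate n b ++ D = D ++ a :: replicate n b) : n ∣ D.count b := by
  match D with
  | [] => simp
  | s :: D =>
    simp only [cons_append, cons.injEq] at h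
    obtain ⟨rfl, h⟩ := h
    rw [count_cons_of_ne hab]
    rcases append_eq_append_iff.1 h with ⟨D, rfl, h'⟩ | ⟨D', h', h''⟩
    · rw [count_append, count_replicate_self]
      exact dvd_add (dvd_refl n) (dvd_count_of_append_comm hab h')
    · cases D' with
      | nil => rw [← h'.trans (append_nil D), count_replicate_self]
      | cons t D' =>
        have : t ∈ replicate n b := by simp [h']
        exact absurd ((cons.inj h'').1.trans (eq_of_mem_replicate this)) hab
termination_by D.length

end Chains

theorem SigDef.count_dvd_count {A : Type*} [DecidableEq A] [Finite A] [HasThirdLetter A] {a b : A}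
    {ι : Type} {i : ℕ} (hab : a ≠ b) (x y : ι) :
    WordDef A (i + 1) fun v => (v x).count b ∣ (v y).count b := by
  have h : WordDef A (i + 1) fun v => ∃ u t d D w : List A, (∀ s ∈ u, s = b) ∧
      u.count b = (v x).count b ∧ t = [a] ∧ d = t ++ u ∧ w = d ++ D ∧ w = D ++ d ∧
      D.count b = (v y).count b :=
    .ex (.ex (.ex (.ex (.ex (.and (.forall_mem _ _) (.and (.count_eq hab.symm _ _)
      (.and (.eq_const _ _) (.and (.eq_append _ _ _) (.and (.eq_append _ _ _)
      (.and (.eq_append _ _ _) (.count_eq hab.symm _ _)))))))))))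
  refine h.congr fun v => ?_
  constructor
  · rintro ⟨k, hk⟩
    refine ⟨List.replicate ((v x).count b) b, _, _,
      (List.replicate k (a :: List.replicate ((v x).count b) b)).flatten, _,
      fun s hs => List.eq_of_mem_replicate hs, List.count_replicate_self, rfl, rfl, rfl,
      append_flatten_replicate_comm _ _, ?_⟩
    simp [List.count_flatten, hab, hk, mul_comm]
  · rintro ⟨u, _, _, D, _, hu, hux, rfl, rfl, rfl, hD, hDy⟩
    obtain ⟨n, rfl⟩ : ∃ n, u = List.replicate n b := ⟨_, List.eq_replicate_of_mem hu⟩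
    rw [List.count_replicate_self] at hux
    rw [← hDy, ← hux]
    exact dvd_count_of_append_comm hab hD

section ReflTransGen

open Relation

variable {A : Type*} {a b : A} [hab : Fact (a ≠ b)] {ι : Type}
variable {E : (ι → ℕ) → (ι → ℕ) → Prop} [Std.Refl E]

theorem vecRel_reflTransGen_iff [DecidableEq A] (x₀ : ι) {w : ι ⊕ ι → List A} :
    vecRel a b (fun v => ReflTransGen E (fun x => v (.inl x)) fun x => v (.inr x)) w ↔
    vecRel a b (fun _ => True) w ∧ ∃ S : ι ⊕ ι → List A,
      vecRel a b (fun v => E (fun x => v (.inl x)) fun x => v (.inr x)) S ∧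
      (w (.inl x₀)).count b ∣ (S (.inr x₀)).count b ∧
      ∀ x, w (.inl x) ++ S (.inr x) = S (.inl x) ++ w (.inr x) := by
  have : Nonempty ι := ⟨x₀⟩
  constructor
  · intro h
    refine ⟨h.imp fun L hL => ⟨fun _ _ => trivial, hL.2⟩, ?_⟩
    obtain ⟨X, Y, hXY, hX, hY⟩ := vecRel_sum_iff.1 h
    have hXY := reflTransGen_forall₂_of_forall₂ hXY
    obtain ⟨S, S', e, hS, hd⟩ := (reflTransGen_forall₂_iff
      (forall₂_of_reflTransGen_forall₂ hXY).length_eq).1 hXY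
    refine ⟨Sum.elim (fun x => enc a b (S.map fun l => l x))
      (fun x => enc a b (S'.map fun l => l x)), vecRel_sum_iff.2 ⟨S, S', hS, fun _ => rfl,
      fun _ => rfl⟩, ?_, fun x => ?_⟩
    · rw [hX]
      simpa [count_enc_right hab.out] using hd
    · rw [hX, hY, Sum.elim_inl, Sum.elim_inr, ← enc_append, ← enc_append, ← List.map_append,
        ← List.map_append, e]
  · rintro ⟨⟨L, -, hL⟩, T, hT, hd, h⟩
    obtain ⟨S, S', hS, hS₁, hS₂⟩ := vecRel_sum_iff.1 hT
    obtain ⟨X, Y, hXY, hX, hY⟩ := (vecRel_sum_iff (E := fun _ _ => True)).1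
      ⟨L, fun _ _ => trivial, hL⟩
    refine vecRel_sum_iff.2 ⟨X, Y, forall₂_of_reflTransGen_forall₂ ?_, hX, hY⟩
    refine (reflTransGen_forall₂_iff hXY.length_eq).2 ⟨S, S', ?_, hS, ?_⟩
    · refine eq_of_map_eval_eq fun x => enc_injective hab.out ?_
      rw [List.map_append, List.map_append, enc_append, enc_append, ← hS₁, ← hS₂, ← hX, ← hY, h]
    · rw [hX, hS₂] at hd
      simpa [count_enc_right hab.out] using hd

theorem VecDef.reflTransGen_of_refl [Finite A] [HasThirdLetter A] [Finite ι] [Nonempty ι] {i : ℕ}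
    (h : VecDef a b i fun v : ι ⊕ ι → ℕ => E (fun x => v (.inl x)) fun x => v (.inr x)) :
    VecDef a b i fun v : ι ⊕ ι → ℕ =>
      ReflTransGen E (fun x => v (.inl x)) fun x => v (.inr x) := by
  classical
  obtain ⟨x₀⟩ := id ‹Nonempty ι›
  have append_eq_append (x : ι) : WordDef A (i + 1) fun w : (ι ⊕ ι) ⊕ (ι ⊕ ι) → List A =>
      ∃ u : List A, u = w (.inl (.inl x)) ++ w (.inr (.inr x)) ∧
        u = w (.inr (.inl x)) ++ w (.inl (.inr x)) :=
    .ex (.and (.eq_append _ _ _) (.eq_append _ _ _))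
  simp only [exists_eq_left] at append_eq_append
  exact (SigDef.and VecDef.true (.exists_fun (.and (SigDef.reindex Sum.inr h)
    (.and (.count_dvd_count hab.out _ _) (.forall_finite append_eq_append))))).congr
    fun w => vecRel_reflTransGen_iff x₀

end ReflTransGen

/-- A step that at most doubles a number: such steps lead from `m` to arbitrarily large numbers
if `m ≠ 0`, and only to `0` if `m = 0`. -/
def DoublingStep (s t : Unit → ℕ) : Prop :=
  s () ≤ t () ∧ t () ≤ s () + s ()

instance : Std.Refl DoublingStep :=
  ⟨fun _ => ⟨le_rfl, Nat.le_add_left _ _⟩⟩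

theorem zero_imp_zero_iff_reflTransGen_doublingStep {m n : ℕ} : (m = 0 → n = 0) ↔
    ∃ t, Relation.ReflTransGen DoublingStep (fun _ => m) t ∧ n ≤ t () := by
  constructor
  · intro h
    have double_pow (k : ℕ) :
        Relation.ReflTransGen DoublingStep (fun _ => m) fun _ => m * 2 ^ k := by
      induction k with
      | zero => simpa using Relation.ReflTransGen.refl
      | succ k ih =>
        refine ih.tail ?_
        rw [DoublingStep, pow_succ, ← mul_assoc, mul_two]
        exact ⟨Nat.le_add_left _ _, le_rfl⟩
    refine ⟨_, double_pow n, ?_⟩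
    rcases m.eq_zero_or_pos with hm | hm
    · simp [h hm]
    · exact n.lt_two_pow_self.le.trans (Nat.le_mul_of_pos_left _ hm)
  · rintro ⟨t, ht, hn⟩ rfl
    have ht : t () = 0 := by
      clear hn
      induction ht with
      | refl => rfl
      | tail _ h ih => exact Nat.le_zero.1 (by simpa [ih] using h.2)
    exact Nat.le_zero.1 (ht ▸ hn)

namespace VecDef

variable {A : Type*} [Finite A] [HasThirdLetter A] {a b : A} [Fact (a ≠ b)] {i : ℕ}
variable {ι : Type} [Finite ι]

theorem zero_imp_zero (x y : ι) : VecDef a b i fun v : ι → ℕ => v x = 0 → v y = 0 := by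
  have h : VecDef a b i fun v : Unit ⊕ Unit → ℕ => v (.inl ()) ≤ v (.inr ()) ∧
      ∃ n, v (.inl ()) + v (.inl ()) = n ∧ v (.inr ()) ≤ n :=
    .and (.le _ _) (.ex (.and (.add _ _ _) (.le _ _)))
  simp only [exists_eq_left'] at h
  have h' := (reflTransGen_of_refl (E := DoublingStep) h).reindex (κ := ι ⊕ Unit)
    (Sum.elim (fun _ => .inl x) fun _ => .inr ())
  exact (VecDef.exists_fun (.and h' (.le (.inl y) (.inr ())))).congr
    fun v => zero_imp_zero_iff_reflTransGen_doublingStep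

theorem zero_imp_eq (x y z : ι) : VecDef a b i fun v : ι → ℕ => v x = 0 → v y = v z := by
  have h : VecDef a b i fun v : ι → ℕ => ∃ d d' s, (v x = 0 → d = 0) ∧ (v x = 0 → d' = 0) ∧
      v y + d = s ∧ v z + d' = s :=
    .ex (.ex (.ex (.and (.zero_imp_zero _ _) (.and (.zero_imp_zero _ _)
      (.and (.add _ _ _) (.add _ _ _))))))
  refine h.congr fun v => ⟨fun h => ?_, ?_⟩
  · refine ⟨v z - v y, v y - v z, max (v y) (v z), ?_, ?_, ?_, ?_⟩ <;> omega
  · rintro ⟨d, d', s, hd, hd', hy, hz⟩ h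
    have := hd h
    have := hd' h
    omega

theorem or {R S : (ι → ℕ) → Prop} (hR : VecDef a b i R) (hS : VecDef a b i S) :
    VecDef a b i fun v => R v ∨ S v := by
  by_cases hR₀ : ∃ v, R v
  swap
  · exact hS.congr fun v => or_iff_right fun hv => hR₀ ⟨v, hv⟩
  by_cases hS₀ : ∃ v, S v
  swap
  · exact hR.congr fun v => or_iff_left fun hv => hS₀ ⟨v, hv⟩
  obtain ⟨r, hr⟩ := hR₀
  obtain ⟨s, hs⟩ := hS₀
  have h : VecDef a b i fun v => ∃ u u' : ι → ℕ, ∃ m m' k, k = 1 ∧ m + m' = k ∧ R u ∧ S u' ∧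
      (∀ x, m = 0 → v x = u x) ∧ ∀ x, m' = 0 → v x = u' x := by
    refine .exists_fun (.exists_fun (.ex (.ex (.ex (.and (.eq_one _) (.and (.add _ _ _)
      (.and ?_ (.and ?_ (.and (.forall_finite fun x => .zero_imp_eq _ _ _)
      (.forall_finite fun x => .zero_imp_eq _ _ _))))))))))
    · exact hR.reindex fun x => some (some (some (Sum.inl (Sum.inr x))))
    · exact hS.reindex fun x => some (some (some (Sum.inr x)))
  refine h.congr fun v => ?_
  constructor
  · rintro (h | h)
    · exact ⟨v, s, 0, 1, 1, rfl, rfl, h, hs, fun _ _ => rfl, fun _ h => absurd h one_ne_zero⟩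
    · exact ⟨r, v, 1, 0, 1, rfl, rfl, hr, h, fun _ h => absurd h one_ne_zero, fun _ _ => rfl⟩
  · rintro ⟨u, u', m, m', k, rfl, hm, hu, hu', h, h'⟩
    rcases m.eq_zero_or_pos with hm₀ | hm₀
    · obtain rfl : v = u := funext fun x => h x hm₀
      exact .inl hu
    · obtain rfl : v = u' := funext fun x => h' x (by omega)
      exact .inr hu'

theorem reflTransGen [Nonempty ι] {E : (ι → ℕ) → (ι → ℕ) → Prop}
    (h : VecDef a b i fun v : ι ⊕ ι → ℕ => E (fun x => v (.inl x)) fun x => v (.inr x)) :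
    VecDef a b i fun v : ι ⊕ ι → ℕ =>
      Relation.ReflTransGen E (fun x => v (.inl x)) fun x => v (.inr x) := by
  rw [← Relation.reflTransGen_reflGen]
  refine reflTransGen_of_refl ((h.or (.forall_finite fun x : ι => .eq (.inr x) (.inl x))).congr
    fun v => ?_)
  rw [Relation.reflGen_iff, or_comm]
  exact or_congr_right funext_iff

end VecDef

/-! ### Recursive functions -/

/-- The step from `(x, k, c k)` to `(x, k + 1, c (k + 1))` for a sequence `c` whose consecutive
members are related by `P x k`. -/
def SeqStep (P : ℕ → ℕ → ℕ → ℕ → Prop) (u v : Fin 3 → ℕ) : Prop :=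
  v 0 = u 0 ∧ v 1 = u 1 + 1 ∧ P (u 0) (u 1) (u 2) (v 2)

section SeqStep

variable {P : ℕ → ℕ → ℕ → ℕ → Prop} {x n s t : ℕ}

theorem exists_seq_of_reflTransGen_seqStep {w : Fin 3 → ℕ}
    (h : Relation.ReflTransGen (SeqStep P) ![x, 0, s] w) : w 0 = x ∧
    ∃ c : ℕ → ℕ, c 0 = s ∧ c (w 1) = w 2 ∧ ∀ k < w 1, P x k (c k) (c (k + 1)) := by
  induction h with
  | refl => exact ⟨rfl, fun _ => s, rfl, rfl, fun _ h => absurd h (Nat.not_lt_zero _)⟩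
  | @tail u v _ h ih =>
    obtain ⟨h₀, h₁, h⟩ := h
    obtain ⟨hu, c, hs, hc, hP⟩ := ih
    refine ⟨h₀.trans hu, fun k => if k ≤ u 1 then c k else v 2, by simp [hs], by simp [h₁],
      fun k hk => ?_⟩
    rcases (Nat.lt_succ_iff_lt_or_eq.1 (h₁ ▸ hk)) with hk | rfl
    · simpa [hk.le, Nat.succ_le_iff, hk] using hP k hk
    · simpa [hc, ← hu] using h

theorem reflTransGen_seqStep_iff : Relation.ReflTransGen (SeqStep P) ![x, 0, s] ![x, n, t] ↔
    ∃ c : ℕ → ℕ, c 0 = s ∧ c n = t ∧ ∀ k < n, P x k (c k) (c (k + 1)) := by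
  constructor
  · exact fun h => (exists_seq_of_reflTransGen_seqStep h).2
  · rintro ⟨c, rfl, rfl, h⟩
    induction n with
    | zero => exact .refl
    | succ n ih =>
      exact (ih fun k hk => h k (hk.trans n.lt_succ_self)).tail ⟨rfl, rfl, h n n.lt_succ_self⟩

end SeqStep

namespace VecDef

variable {A : Type*} [Finite A] [HasThirdLetter A] {a b : A} [Fact (a ≠ b)] {i : ℕ}
variable {ι : Type} [Finite ι]

theorem exists_seq {P : ℕ → ℕ → ℕ → ℕ → Prop}
    (hP : VecDef a b i fun v : Fin 4 → ℕ => P (v 0) (v 1) (v 2) (v 3)) (x n s t : ι) :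
    VecDef a b i fun v : ι → ℕ =>
      ∃ c : ℕ → ℕ, c 0 = v s ∧ c (v n) = v t ∧ ∀ k < v n, P (v x) k (c k) (c (k + 1)) := by
  have hE : VecDef a b i fun v : Fin 3 ⊕ Fin 3 → ℕ => v (.inr 0) = v (.inl 0) ∧
      v (.inr 1) = v (.inl 1) + 1 ∧ P (v (.inl 0)) (v (.inl 1)) (v (.inl 2)) (v (.inr 2)) :=
    .and (.eq _ _) (.and (.eq_succ _ _) (hP.reindex ![Sum.inl 0, .inl 1, .inl 2, .inr 2]))
  have h : VecDef a b i fun v : Option ι → ℕ => Relation.ReflTransGen (SeqStep P)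
      ![v (some x), v none, v (some s)] ![v (some x), v (some n), v (some t)] := by
    refine ((reflTransGen (E := SeqStep P) hE).reindex
      (Sum.elim ![some x, none, some s] ![some x, some n, some t])).congr fun v => ?_
    have comp_eq (x y z : Option ι) : ![v x, v y, v z] = fun k => v (![x, y, z] k) := by
      funext k
      fin_cases k <;> rfl
    rw [comp_eq, comp_eq]
    rfl
  have h' : VecDef a b i fun v : ι → ℕ => ∃ o, o = 0 ∧
      Relation.ReflTransGen (SeqStep P) ![v x, o, v s] ![v x, v n, v t] :=
    .ex (.and (.eq_zero _) h)
  simpa only [exists_eq_left, reflTransGen_seqStep_iff] using h'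

theorem forall_lt {P : ℕ → ℕ → Prop} (hP : VecDef a b i fun v : Fin 2 → ℕ => P (v 0) (v 1))
    (x n : ι) : VecDef a b i fun v : ι → ℕ => ∀ k < v n, P (v x) k := by
  have h : VecDef a b i fun v : ι → ℕ => ∃ s t, ∃ c : ℕ → ℕ, c 0 = s ∧ c (v n) = t ∧
      ∀ k < v n, P (v x) k :=
    .ex (.ex (exists_seq (P := fun x k _ _ => P x k) (hP.reindex ![0, 1]) _ _ _ _))
  exact h.congr fun v => ⟨fun h => ⟨0, 0, fun _ => 0, rfl, rfl, h⟩, fun ⟨_, _, _, _, _, h⟩ => h⟩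

theorem mul (x y z : ι) : VecDef a b i fun v : ι → ℕ => v x * v y = v z := by
  have h : VecDef a b i fun v : ι → ℕ => ∃ s, s = 0 ∧ ∃ c : ℕ → ℕ, c 0 = s ∧ c (v x) = v z ∧
      ∀ k < v x, c k + v y = c (k + 1) :=
    .ex (.and (.eq_zero _) (.exists_seq (P := fun y _ s t => s + y = t) (.add _ _ _) _ _ _ _))
  refine h.congr fun v => ⟨fun h => ⟨0, rfl, fun k => k * v y, zero_mul _, h, ?_⟩, ?_⟩
  · exact fun k _ => (Nat.succ_mul k _).symm
  · rintro ⟨_, rfl, c, h₀, hc, hP⟩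
    have mul_eq (k : ℕ) (hk : k ≤ v x) : k * v y = c k := by
      induction k with
      | zero => rw [zero_mul, h₀]
      | succ k ih => rw [Nat.succ_mul, ih (by omega), hP k hk]
    exact (mul_eq _ le_rfl).trans hc

theorem eq_pair (x y z : ι) : VecDef a b i fun v : ι → ℕ => v z = Nat.pair (v x) (v y) := by
  have h : VecDef a b i fun v : ι → ℕ =>
      (v x < v y ∧ ∃ s, v y * v y = s ∧ s + v x = v z) ∨
      (v y ≤ v x ∧ ∃ s t, v x * v x = s ∧ s + v x = t ∧ t + v y = v z) :=
    .or (.and (.lt _ _) (.ex (.and (.mul _ _ _) (.add _ _ _))))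
      (.and (.le _ _) (.ex (.ex (.and (.mul _ _ _) (.and (.add _ _ _) (.add _ _ _))))))
  refine h.congr fun v => ?_
  rw [Nat.pair]
  split_ifs with hxy
  · simp [hxy, hxy.not_ge, eq_comm]
  · simp [hxy, not_lt.1 hxy, eq_comm]

end VecDef

/-- The graph of the partial function `f`, applied in all positions of vectors, is definable at
level `i + 1`. -/
def GraphDef {A : Type*} (a b : A) (i : ℕ) (f : ℕ →. ℕ) : Prop :=
  ∀ ⦃κ : Type⦄ [Finite κ] (x y : κ), VecDef a b i fun v : κ → ℕ => v y ∈ f (v x)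

namespace GraphDef

variable {A : Type*} [Finite A] [HasThirdLetter A] {a b : A} [Fact (a ≠ b)] {i : ℕ}
variable {f g : ℕ →. ℕ}

theorem unpair_left : GraphDef a b i fun n : ℕ => n.unpair.1 := by
  intro κ _ x y
  have h : VecDef a b i fun v : κ → ℕ => ∃ n, v x = Nat.pair (v y) n := .ex (.eq_pair _ _ _)
  refine h.congr fun v => Part.mem_some_iff.trans ⟨fun h => ⟨(v x).unpair.2, ?_⟩, ?_⟩
  · rw [h, Nat.pair_unpair]
  · rintro ⟨n, h⟩
    rw [h, Nat.unpair_pair]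

theorem unpair_right : GraphDef a b i fun n : ℕ => n.unpair.2 := by
  intro κ _ x y
  have h : VecDef a b i fun v : κ → ℕ => ∃ n, v x = Nat.pair n (v y) := .ex (.eq_pair _ _ _)
  refine h.congr fun v => Part.mem_some_iff.trans ⟨fun h => ⟨(v x).unpair.1, ?_⟩, ?_⟩
  · rw [h, Nat.pair_unpair]
  · rintro ⟨n, h⟩
    rw [h, Nat.unpair_pair]

theorem pair (hf : GraphDef a b i f) (hg : GraphDef a b i g) :
    GraphDef a b i fun n => Nat.pair <$> f n <*> g n := by
  intro κ _ x y
  have h : VecDef a b i fun v : κ → ℕ => ∃ m n, m ∈ f (v x) ∧ n ∈ g (v x) ∧ v y = Nat.pair m n :=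
    .ex (.ex (.and (hf _ _) (.and (hg _ _) (.eq_pair _ _ _))))
  refine h.congr fun v => ?_
  simp only [Seq.seq, Part.map_eq_map, Part.mem_bind_iff, Part.mem_map_iff]
  constructor
  · rintro ⟨_, ⟨m, hm, rfl⟩, n, hn, e⟩
    exact ⟨m, n, hm, hn, e.symm⟩
  · rintro ⟨m, n, hm, hn, e⟩
    exact ⟨_, ⟨m, hm, rfl⟩, n, hn, e.symm⟩

theorem comp (hf : GraphDef a b i f) (hg : GraphDef a b i g) :
    GraphDef a b i fun n => g n >>= f := by
  intro κ _ x y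
  have h : VecDef a b i fun v : κ → ℕ => ∃ m, m ∈ g (v x) ∧ v y ∈ f m :=
    .ex (.and (hg _ _) (hf _ _))
  exact h.congr fun v => Part.mem_bind_iff

theorem mem_rec_iff {m n r : ℕ} :
    r ∈ Nat.rec (motive := fun _ => Part ℕ) (f m)
      (fun y IH => IH >>= fun i => g (Nat.pair m (Nat.pair y i))) n ↔
    ∃ s, s ∈ f m ∧ ∃ c : ℕ → ℕ, c 0 = s ∧ c n = r ∧
      ∀ k < n, c (k + 1) ∈ g (Nat.pair m (Nat.pair k (c k))) := by
  constructor
  · intro h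
    induction n generalizing r with
    | zero => exact ⟨r, h, fun _ => r, rfl, rfl, fun _ h => absurd h (Nat.not_lt_zero _)⟩
    | succ n ih =>
      obtain ⟨t, ht, hr⟩ := Part.mem_bind_iff.1 h
      obtain ⟨s, hs, c, hcs, hct, hc⟩ := ih ht
      refine ⟨s, hs, fun k => if k ≤ n then c k else r, by simp [hcs], by simp, fun k hk => ?_⟩
      rcases Nat.lt_succ_iff_lt_or_eq.1 hk with hk | rfl
      · simpa [hk.le, Nat.succ_le_iff, hk] using hc k hk
      · simpa [hct] using hr
  · rintro ⟨_, hs, c, rfl, rfl, hc⟩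
    induction n with
    | zero => exact hs
    | succ n ih =>
      exact Part.mem_bind_iff.2
        ⟨c n, ih fun k hk => hc k (hk.trans n.lt_succ_self), hc n n.lt_succ_self⟩

theorem prec (hf : GraphDef a b i f) (hg : GraphDef a b i g) :
    GraphDef a b i fun p => Nat.rec (motive := fun _ => Part ℕ) (f p.unpair.1)
      (fun y IH => IH >>= fun i => g (Nat.pair p.unpair.1 (Nat.pair y i))) p.unpair.2 := by
  intro κ _ x y
  have hP : VecDef a b i fun v : Fin 4 → ℕ => ∃ p q, p = Nat.pair (v 1) (v 2) ∧
      q = Nat.pair (v 0) p ∧ v 3 ∈ g q :=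
    .ex (.ex (.and (.eq_pair _ _ _) (.and (.eq_pair _ _ _) (hg _ _))))
  simp only [exists_and_left, exists_eq_left] at hP
  have h : VecDef a b i fun v : κ → ℕ => ∃ m n, v x = Nat.pair m n ∧ ∃ s, s ∈ f m ∧
      ∃ c : ℕ → ℕ, c 0 = s ∧ c n = v y ∧
      ∀ k < n, c (k + 1) ∈ g (Nat.pair m (Nat.pair k (c k))) :=
    .ex (.ex (.and (.eq_pair _ _ _) (.ex (.and (hf _ _) (.exists_seq
      (P := fun m k s t => t ∈ g (Nat.pair m (Nat.pair k s))) hP _ _ _ _)))))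
  refine h.congr fun v => (mem_rec_iff (g := g)).trans
    ⟨fun h => ⟨_, _, (Nat.pair_unpair _).symm, h⟩, ?_⟩
  rintro ⟨m, n, e, h⟩
  rwa [e, Nat.unpair_pair]

theorem rfind (hf : GraphDef a b i f) : GraphDef a b i fun m =>
    Nat.rfind fun n => (fun m => decide (m = 0)) <$> f (Nat.pair m n) := by
  intro κ _ x y
  have hP : VecDef a b i fun v : Fin 2 → ℕ => ∃ p r z, p = Nat.pair (v 0) (v 1) ∧ r ∈ f p ∧
      z = 0 ∧ z < r :=
    .ex (.ex (.ex (.and (.eq_pair _ _ _) (.and (hf _ _) (.and (.eq_zero _) (.lt _ _))))))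
  simp only [exists_and_left, exists_eq_left] at hP
  have h : VecDef a b i fun v : κ → ℕ => (∃ p z, p = Nat.pair (v x) (v y) ∧ z = 0 ∧ z ∈ f p) ∧
      ∀ k < v y, ∃ r ∈ f (Nat.pair (v x) k), 0 < r :=
    .and (.ex (.ex (.and (.eq_pair _ _ _) (.and (.eq_zero _) (hf _ _)))))
      (.forall_lt (P := fun m k => ∃ r ∈ f (Nat.pair m k), 0 < r) hP _ _)
  refine h.congr fun v => Nat.mem_rfind.trans ?_
  simp [Nat.pos_iff_ne_zero]

theorem of_recursiveIn {O : Set (ℕ →. ℕ)} (hO : ∀ g ∈ O, GraphDef a b i g)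
    (hf : Nat.RecursiveIn O f) : GraphDef a b i f := by
  induction hf with
  | zero => exact fun κ _ x y => (VecDef.eq_zero y).congr fun v => Part.mem_some_iff
  | succ => exact fun κ _ x y => (VecDef.eq_succ x y).congr fun v => Part.mem_some_iff
  | left => exact unpair_left
  | right => exact unpair_right
  | oracle g hg => exact hO g hg
  | pair _ _ ihf ihg => exact ihf.pair ihg
  | comp _ _ ihf ihg => exact ihf.comp ihg
  | prec _ _ ihf ihg => exact ihf.prec ihg
  | rfind _ ihf => exact ihf.rfind

end GraphDef

/-! ### Relations in the arithmetical hierarchy are definable -/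

section NegationAndOracles

variable {A : Type*} {a b : A} [hab : Fact (a ≠ b)] {ι : Type}

/-- All members of a sequence of vectors violate `R` iff no nonempty contiguous block of the
sequence lies in `R`, which is a negated existential condition. -/
theorem vecRel_not_iff [Nonempty ι] {R : (ι → ℕ) → Prop} {w : ι → List A} :
    vecRel a b (fun v => ¬ R v) w ↔ vecRel a b (fun _ => True) w ∧ ¬ ∃ u t t' y : ι → List A,
      vecRel a b (fun _ => True) u ∧ vecRel a b R t ∧ vecRel a b (fun _ => True) t' ∧
      ∀ x, [b].Sublist (t x) ∧ y x = u x ++ t x ∧ w x = y x ++ t' x := by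
  constructor
  · rintro ⟨L, hL, h⟩
    refine ⟨⟨L, fun _ _ => trivial, h⟩, ?_⟩
    rintro ⟨u, t, t', y, ⟨U, -, hU⟩, ⟨T, hT, ht⟩, ⟨T', -, ht'⟩, hw⟩
    obtain rfl : L = U ++ T ++ T' := by
      refine eq_of_map_eval_eq fun x => enc_injective hab.out ?_
      rw [← h, (hw x).2.2, (hw x).2.1, hU, ht, ht', List.map_append, List.map_append, enc_append,
        enc_append]
    obtain ⟨l, hl⟩ : ∃ l, l ∈ T := by
      refine List.exists_mem_of_ne_nil T ?_
      rintro rfl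
      have := (hw (Classical.arbitrary ι)).1
      rw [ht] at this
      simp [enc] at this
    exact hL l (by simp [hl]) (hT l hl)
  · rintro ⟨⟨L, -, h⟩, h'⟩
    refine ⟨L, fun l hl hR => h' ?_, h⟩
    obtain ⟨U, T', rfl⟩ := List.append_of_mem hl
    refine ⟨fun x => enc a b (U.map fun l => l x), fun x => enc a b [l x],
      fun x => enc a b (T'.map fun l => l x), _, ⟨U, fun _ _ => trivial, fun _ => rfl⟩,
      ⟨[l], by simpa using hR, fun _ => rfl⟩, ⟨T', fun _ _ => trivial, fun _ => rfl⟩,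
      fun x => ⟨by simp [enc], rfl, ?_⟩⟩
    rw [h, ← enc_append, ← enc_append]
    simp

namespace VecDef

variable [Finite A] [HasThirdLetter A] [Finite ι] {i : ℕ}

theorem not {R : (ι → ℕ) → Prop} (hR : VecDef a b i R) : VecDef a b (i + 1) fun v => ¬ R v := by
  rcases isEmpty_or_nonempty ι with hι | hι
  · exact (VecDef.prop (¬ R isEmptyElim)).congr fun v =>
      Eq.to_iff (congrArg (¬ R ·) (Subsingleton.elim _ _))
  have true_vec : VecDef a b i fun _ : ι → ℕ => True := .true
  have h : WordDef A (i + 1) fun w => ∃ u t t' y : ι → List A,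
      vecRel a b (fun _ => True) u ∧ vecRel a b R t ∧ vecRel a b (fun _ => True) t' ∧
      ∀ x, [b].Sublist (t x) ∧ y x = u x ++ t x ∧ w x = y x ++ t' x :=
    .exists_fun (.exists_fun (.exists_fun (.exists_fun
      (.and (SigDef.reindex (fun x => Sum.inl (Sum.inl (Sum.inl (Sum.inr x)))) true_vec)
      (.and (SigDef.reindex (fun x => Sum.inl (Sum.inl (Sum.inr x))) hR)
      (.and (SigDef.reindex (fun x => Sum.inl (Sum.inr x)) true_vec)
      (.forall_finite fun x => .and (.const_sublist _ _)
      (.and (.eq_append _ _ _) (.eq_append _ _ _)))))))))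
  exact (SigDef.and (VecDef.true (a := a) (b := b)) h.not).congr fun w => vecRel_not_iff

theorem mem_of_recursiveIn {O : Set (ℕ →. ℕ)} (hO : ∀ g ∈ O, GraphDef a b i g) {S : Set ℕ}
    (hS : RecursiveIn O fun n => Part.assert (n ∈ S) fun _ => Part.some ()) (x : ι) :
    VecDef a b i fun v : ι → ℕ => v x ∈ S := by
  have h : VecDef a b i fun v : ι → ℕ => ∃ n, n ∈ Part.bind (Encodable.decode (α := ℕ) (v x))
      fun m => (Part.assert (m ∈ S) fun _ => Part.some ()).map Encodable.encode :=
    .ex (GraphDef.of_recursiveIn hO hS _ _)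
  exact h.congr fun v => by simp

theorem mem_of_arithmeticalSigma {S : Set ℕ} (hS : ArithmeticalSigma (i + 1) S) (x : ι) :
    VecDef a b i fun v : ι → ℕ => v x ∈ S := by
  induction i generalizing S ι with
  | zero =>
    exact mem_of_recursiveIn (O := ∅) (fun _ h => absurd h (Set.notMem_empty _))
      (Partrec.recursiveIn hS) x
  | succ i ih =>
    obtain ⟨T, hT, hS⟩ := hS
    refine mem_of_recursiveIn ?_ hS x
    rintro _ rfl κ _ x y
    have h : VecDef a b (i + 1) fun v : κ → ℕ => (v x ∈ T ∧ v y = 1) ∨ (v x ∉ T ∧ v y = 0) :=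
      .or (.and (ih hT _).succ (.eq_one _)) (.and (ih hT _).not (.eq_zero _))
    refine h.congr fun v => ?_
    by_cases hx : v x ∈ T <;> simp [membershipOracle, hx]

end VecDef

end NegationAndOracles

/-! ### Codes of words -/

section Gaps

variable {A : Type*} [DecidableEq A] {p q : A}

/-- How reading the letter `s` in front of a word changes the length of the first block and the
list of the lengths of the other blocks in `gaps`. -/
def gapsStep (p q s : A) (D : ℕ × List ℕ) : ℕ × List ℕ :=
  if s = p then (D.1 + 1, D.2) else if s = q then (0, D.1 :: D.2) else D

/-- The numbers of letters `p` before, between and after the letters `q` of a word. They determine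
the projection of the word to `p` and `q` and are a primitive recursive function of the word. -/
def gaps (p q : A) (x : List A) : List ℕ :=
  let D := x.foldr (gapsStep p q) (0, [])
  D.1 :: D.2

theorem enc_gaps (p q : A) (x : List A) : enc p q (gaps p q x) = proj p q x ++ [q] := by
  induction x with
  | nil => rfl
  | cons s x ih =>
    rw [gaps, List.foldr_cons, gapsStep]
    split_ifs with hp hq
    · rw [hp, proj_cons_left, List.cons_append, ← ih]
      rfl
    · rw [hq, proj_cons_right, List.cons_append, ← ih]
      rfl
    · rw [proj_cons_of_ne hp hq, ← ih]
      rfl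

theorem eq_of_gaps_eq [Nontrivial A] {x y : List A}
    (h : ∀ p q, p ≠ q → gaps p q x = gaps p q y) : x = y :=
  eq_of_proj_eq fun p q hpq =>
    List.append_cancel_right ((enc_gaps p q x).symm.trans ((h p q hpq) ▸ enc_gaps p q y))

theorem primrec_gaps [Primcodable A] (p q : A) : Primrec (gaps p q) := by
  have fst_state : Primrec fun z : List A × A × ℕ × List ℕ => z.2.2.1 :=
    Primrec.fst.comp (Primrec.snd.comp Primrec.snd)
  have snd_state : Primrec fun z : List A × A × ℕ × List ℕ => z.2.2.2 :=
    Primrec.snd.comp (Primrec.snd.comp Primrec.snd)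
  have letter : Primrec fun z : List A × A × ℕ × List ℕ => z.2.1 :=
    Primrec.fst.comp Primrec.snd
  have step : Primrec₂ fun (_ : List A) (z : A × ℕ × List ℕ) => gapsStep p q z.1 z.2 :=
    Primrec.ite (Primrec.eq.comp letter (Primrec.const p))
      (Primrec.pair (Primrec.succ.comp fst_state) snd_state)
      (Primrec.ite (Primrec.eq.comp letter (Primrec.const q))
        (Primrec.pair (Primrec.const 0) (Primrec.list_cons.comp fst_state snd_state))
        (Primrec.snd.comp Primrec.snd))
  have fold := Primrec.list_foldr Primrec.id (Primrec.const (0, [])) step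
  exact Primrec.list_cons.comp (Primrec.fst.comp fold) (Primrec.snd.comp fold)

end Gaps

/-- The computation of the code of a list, as a list of triples of the code of a suffix, its first
entry and the code of the rest. -/
theorem encode_eq_iff_exists {l : List ℕ} {m : ℕ} :
    Encodable.encode l = m ↔ ∃ L : List (Fin 3 → ℕ), (∀ s ∈ L, s 0 = Nat.pair (s 1) (s 2) + 1) ∧
      L.map (fun s => s 1) = l ∧ L.map (fun s => s 0) ++ [0] = m :: L.map (fun s => s 2) := by
  induction l generalizing m with
  | nil =>
    constructor
    · rintro rfl
      exact ⟨[], by simp⟩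
    · rintro ⟨L, -, h, h'⟩
      rw [List.map_eq_nil_iff] at h
      subst h
      simpa using h'
  | cons n l ih =>
    rw [Encodable.encode_list_cons]
    constructor
    · rintro rfl
      obtain ⟨L, h₁, h₂, h₃⟩ := ih.1 rfl
      refine ⟨![Nat.pair n (Encodable.encode l) + 1, n, Encodable.encode l] :: L,
        List.forall_mem_cons.2 ⟨rfl, h₁⟩, by simp [h₂], ?_⟩
      rw [List.map_cons, List.cons_append, h₃]
      rfl
    · rintro ⟨L, h₁, h₂, h₃⟩
      cases L with
      | nil => simp at h₂
      | cons s L =>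
        simp only [List.map_cons, List.cons.injEq, List.cons_append] at h₂ h₃
        rw [List.forall_mem_cons] at h₁
        rw [← h₃.1, h₁.1, h₂.1, ih.2 ⟨L, h₁.2, h₂.2, h₃.2⟩]
        rfl

section WordCodes

variable {A : Type*} {a b p q : A}

theorem exists_eq_enc_singleton_iff [DecidableEq A] (hab : a ≠ b) {z : List A} :
    (∃ n, z = enc a b [n]) ↔ (∃ l, z = enc a b l) ∧ z.count b = 1 := by
  constructor
  · rintro ⟨n, rfl⟩
    exact ⟨⟨_, rfl⟩, count_enc_right hab _⟩
  · rintro ⟨⟨l, rfl⟩, h⟩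
    rw [count_enc_right hab, List.length_eq_one_iff] at h
    obtain ⟨n, rfl⟩ := h
    exact ⟨n, rfl⟩

variable [Finite A] [HasThirdLetter A] {ι : Type} {i : ℕ}

namespace SigDef

theorem exists_eq_enc_singleton (hab : a ≠ b) (x : ι) :
    WordDef A (i + 1) fun v => ∃ n, v x = enc a b [n] := by
  classical
  simp only [exists_eq_enc_singleton_iff hab]
  exact .and (.exists_eq_enc hab _) (.count_eq_one _ _)

theorem enc_encode (hpq : p ≠ q) (x z : ι) : WordDef A (i + 1) fun v =>
    ∃ l : List ℕ, v x = enc p q l ∧ v z = enc p q [Encodable.encode l] := by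
  have : Fact (p ≠ q) := ⟨hpq⟩
  have hP : VecDef p q i fun s : Fin 3 → ℕ => ∃ n, n = Nat.pair (s 1) (s 2) ∧ s 0 = n + 1 :=
    .ex (.and (.eq_pair _ _ _) (.eq_succ _ _))
  simp only [exists_eq_left] at hP
  have h : WordDef A (i + 1) fun v => ∃ C : Fin 3 → List A, ∃ t D : List A,
      vecRel p q (fun s : Fin 3 → ℕ => s 0 = Nat.pair (s 1) (s 2) + 1) C ∧ v x = C 1 ∧
      (∃ m, v z = enc p q [m]) ∧ t = [q] ∧ D = C 0 ++ t ∧ D = v z ++ C 2 :=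
    .exists_fun (.ex (.ex (.and (SigDef.reindex (fun j => some (some (Sum.inr j))) hP)
      (.and (.eq _ _) (.and (.exists_eq_enc_singleton hpq _) (.and (.eq_const _ _)
      (.and (.eq_append _ _ _) (.eq_append _ _ _))))))))
  refine h.congr fun v => ⟨?_, ?_⟩
  · rintro ⟨l, hx, hz⟩
    obtain ⟨L, h₁, h₂, h₃⟩ := encode_eq_iff_exists.1 (rfl : Encodable.encode l = _)
    refine ⟨fun j => enc p q (L.map fun s => s j), enc p q [0], _, ⟨L, h₁, fun _ => rfl⟩,
      hx.trans (h₂ ▸ rfl), ⟨_, hz⟩, rfl, rfl, ?_⟩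
    rw [hz, ← enc_append, ← enc_append, h₃]
    rfl
  · rintro ⟨C, t, D, ⟨L, h₁, hC⟩, hx, ⟨m, hz⟩, rfl, rfl, h₂⟩
    have h₃ : enc p q (L.map (fun s => s 0) ++ [0]) = enc p q (m :: L.map fun s => s 2) :=
      calc enc p q (L.map (fun s => s 0) ++ [0])
        _ = C 0 ++ [q] := by rw [enc_append, hC]; rfl
        _ = v z ++ C 2 := h₂
        _ = enc p q ([m] ++ L.map fun s => s 2) := by rw [enc_append, hz, hC]
    refine ⟨_, hx.trans (hC 1), ?_⟩
    rw [encode_eq_iff_exists.2 ⟨L, h₁, rfl, enc_injective hpq h₃⟩, hz]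

theorem eq_enc_encode_gaps [DecidableEq A] (hab : a ≠ b) (hpq : p ≠ q) (x z : ι) :
    WordDef A (i + 1) fun v => v z = enc a b [Encodable.encode (gaps p q (v x))] := by
  have h : WordDef A (i + 1) fun v => ∃ y t u c : List A, y = proj p q (v x) ∧ t = [q] ∧
      u = y ++ t ∧ (∃ l : List ℕ, u = enc p q l ∧ c = enc p q [Encodable.encode l]) ∧
      (∃ n, v z = enc a b [n]) ∧ (v z).count a = c.count p := by
    refine .ex (.ex (.ex (.ex (.and (.eq_proj hpq _ _) (.and (.eq_const _ _)
      (.and (.eq_append _ _ _) (.and (.enc_encode hpq _ _)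
      (.and (.exists_eq_enc_singleton hab _) ?_))))))))
    rcases eq_or_ne a p with rfl | hap
    · exact .count_eq hab _ _
    · exact .count_eq_count hap _ _
  refine h.congr fun v => ⟨fun hz => ?_, ?_⟩
  · refine ⟨_, _, _, _, rfl, rfl, rfl, ⟨_, (enc_gaps p q _).symm, rfl⟩, ⟨_, hz⟩, ?_⟩
    rw [hz, count_enc_left hab, count_enc_left hpq]
  · rintro ⟨_, _, _, _, rfl, rfl, rfl, ⟨l, hl, rfl⟩, ⟨n, hz⟩, hc⟩
    obtain rfl : gaps p q (v x) = l := enc_injective hpq ((enc_gaps p q _).trans hl)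
    rw [hz, count_enc_left hab, count_enc_left hpq] at hc
    rw [hz, List.sum_singleton.symm.trans (hc.trans List.sum_singleton)]

end SigDef

end WordCodes

theorem VecDef.exists_mem_of_inSigmaZero {A : Type*} [Finite A] [HasThirdLetter A] {a b : A}
    [Fact (a ≠ b)] {α : Type*} [Primcodable α] {i : ℕ} {R : Set α} (hR : InSigmaZero (i + 1) R)
    {κ : Type} [Finite κ] {F : κ → α → ℕ} (hF : ∀ j, Computable (F j)) :
    VecDef a b i fun s : κ → ℕ => ∃ u ∈ R, ∀ j, s j = F j u := by
  have h : VecDef a b i fun s : κ → ℕ => ∃ n, n ∈ Encodable.encode '' R ∧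
      ∀ j, s j ∈ Part.bind (Encodable.decode (α := α) n) fun u =>
        (Part.some (F j u)).map Encodable.encode :=
    .ex (.and (.mem_of_arithmeticalSigma hR _) (.forall_finite fun j =>
      GraphDef.of_recursiveIn (O := ∅) (fun _ h => absurd h (Set.notMem_empty _))
        (Nat.Partrec.recursiveIn (hF j)) _ _))
  exact h.congr fun s => by simp

theorem SigDef.of_inSigmaZero {A : Type*} [Finite A] [HasThirdLetter A] [Primcodable A]
    {i k : ℕ} {R : Set (Fin k → List A)} (hR : InSigmaZero (i + 1) R) :
    WordDef A (i + 1) fun v => v ∈ R := by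
  classical
  rcases isEmpty_or_nonempty (Fin k) with hk | hk
  · exact (SigDef.prop (isEmptyElim ∈ R)).congr fun v =>
      Eq.to_iff (congrArg (· ∈ R) (Subsingleton.elim _ _))
  obtain ⟨a, b, hab⟩ := exists_pair_ne A
  have : Fact (a ≠ b) := ⟨hab⟩
  obtain ⟨n, ⟨e⟩⟩ := Finite.exists_equiv_fin A
  let κ := Fin k × {c : Fin n × Fin n // e.symm c.1 ≠ e.symm c.2}
  have : Nonempty κ := ⟨Classical.arbitrary _, (e a, e b), by simpa using hab⟩
  let F (c : κ) (v : Fin k → List A) : ℕ :=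
    Encodable.encode (gaps (e.symm c.2.1.1) (e.symm c.2.1.2) (v c.1))
  have hF (c : κ) : Computable (F c) := (Primrec.encode.comp ((primrec_gaps _ _).comp
    (Primrec.fin_app.comp Primrec.id (Primrec.const c.1)))).to_comp
  have F_injective {u v : Fin k → List A} (h : ∀ c, F c u = F c v) : u = v :=
    funext fun j => eq_of_gaps_eq fun p q hpq => Encodable.encode_injective
      (by simpa [F] using h ⟨j, (e p, e q), by simpa using hpq⟩)
  have code_mem : VecDef a b i fun s : κ → ℕ => ∃ u ∈ R, ∀ c, s c = F c u :=
    .exists_mem_of_inSigmaZero hR hF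
  have h : WordDef A (i + 1) fun v : Fin k → List A => ∃ w : κ → List A,
      vecRel a b (fun s : κ → ℕ => ∃ u ∈ R, ∀ c, s c = F c u) w ∧ ∀ c, w c = enc a b [F c v] :=
    .exists_fun (.and (SigDef.reindex Sum.inr code_mem) (.forall_finite fun c : κ =>
      .eq_enc_encode_gaps hab c.2.2 _ _))
  refine h.congr fun v => ?_
  have vecRel_code {w : κ → List A} (hw : ∀ c, w c = enc a b [F c v]) :
      vecRel a b (fun s : κ → ℕ => ∃ u ∈ R, ∀ c, s c = F c u) w ↔ ∃ u ∈ R, ∀ c, F c v = F c u :=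
    (vecRel_iff (L := [fun c => F c v]) hw).trans List.forall_mem_singleton
  constructor
  · exact fun hv => ⟨_, (vecRel_code fun _ => rfl).2 ⟨v, hv, fun _ => rfl⟩, fun _ => rfl⟩
  · rintro ⟨w, hR, hw⟩
    obtain ⟨u, hu, huv⟩ := (vecRel_code hw).1 hR
    rwa [F_injective huv]

/-! ### Definable relations belong to the arithmetical hierarchy -/

theorem REIn.exists_not_mem (T : Set ℕ) : REIn T {n | ∃ m, Nat.pair n m ∉ T} := by
  let search (n : ℕ) : Part ℕ :=
    Nat.rfind fun m => (fun k => decide (k = 0)) <$> membershipOracle T (Nat.pair n m)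
  have search_dom (n : ℕ) : (search n).Dom ↔ ∃ m, Nat.pair n m ∉ T :=
    Nat.rfind_dom.trans (by simp [membershipOracle])
  have h : Nat.RecursiveIn {membershipOracle T} fun n => search n >>= fun _ => Part.some 0 :=
    .comp .zero (.rfind (.oracle _ rfl))
  refine h.of_eq fun n => Part.ext' ?_ fun _ _ => ?_
  · simp [search_dom, Part.assert]
  · rfl

theorem REIn.rePred {T S : Set ℕ} (hT : ComputablePred fun n => n ∈ T) (h : REIn T S) :
    REPred fun n => n ∈ S := by
  refine Nat.RecursiveIn.partrec_of_oracle ?_ h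
  rintro _ rfl
  obtain ⟨f, hf, hfT⟩ := ComputablePred.computable_iff.1 hT
  have h' : Computable fun n => cond (f n) 1 0 :=
    Computable.cond hf (Computable.const 1) (Computable.const 0)
  refine (Partrec.nat_iff.1 h').of_eq fun n => ?_
  have hn : n ∈ T ↔ f n = true := Eq.to_iff (congrFun hfT n)
  cases hfn : f n <;> simp [membershipOracle, hn, hfn]

theorem ArithmeticalSigma.exists_not_mem {i : ℕ} {T : Set ℕ} (h : ArithmeticalSigma i T) :
    ArithmeticalSigma (i + 1) {n | ∃ m, Nat.pair n m ∉ T} := by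
  cases i with
  | zero => exact REIn.rePred h (.exists_not_mem T)
  | succ i => exact ⟨T, h, .exists_not_mem T⟩

section DecodeD

variable {α : Type*} [Primcodable α] [Inhabited α]

variable (α) in
/-- Decoding as a total function, with the default value at the numbers that are not codes. -/
def decodeD (n : ℕ) : α :=
  (Encodable.decode n).getD default

theorem decodeD_encode (u : α) : decodeD α (Encodable.encode u) = u := by
  rw [decodeD, Encodable.encodek, Option.getD_some]

theorem decodeD_surjective : Function.Surjective (decodeD α) :=
  fun u => ⟨_, decodeD_encode u⟩

theorem primrec_decodeD : Primrec (decodeD α) :=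
  Primrec.option_getD.comp Primrec.decode (Primrec.const default)

theorem mem_image_encode_iff {R : Set α} {n : ℕ} :
    n ∈ Encodable.encode '' R ↔ Encodable.encode (decodeD α n) = n ∧ decodeD α n ∈ R := by
  constructor
  · rintro ⟨u, hu, rfl⟩
    rw [decodeD_encode]
    exact ⟨rfl, hu⟩
  · rintro ⟨hn, hu⟩
    exact ⟨_, hu, hn⟩

end DecodeD

section Sublist

variable {A : Type*}

theorem foldl_eq_nil_iff_sublist [DecidableEq A] (u v : List A) :
    v.foldl (fun u s => if u.head? = some s then u.tail else u) u = [] ↔ u.Sublist v := by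
  induction v generalizing u with
  | nil => simp
  | cons s v ih =>
    rw [List.foldl_cons, ih]
    cases u with
    | nil => simp
    | cons r u =>
      rcases eq_or_ne r s with rfl | h
      · simp
      · rw [List.head?_cons, if_neg (by simpa using h)]
        exact ⟨.cons s, fun h' => (List.sublist_cons_iff.1 h').resolve_right
          fun ⟨_, hr, _⟩ => h (List.cons.inj hr).1⟩

variable [Primcodable A]

theorem primrecRel_sublist : PrimrecRel fun u v : List A => u.Sublist v := by
  classical
  have h : Primrec₂ fun (_ : List A × List A) (z : List A × A) =>
      if z.1.head? = some z.2 then z.1.tail else z.1 := by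
    have word : Primrec fun z : (List A × List A) × (List A × A) => z.2.1 :=
      Primrec.fst.comp Primrec.snd
    have letter : Primrec fun z : (List A × List A) × (List A × A) => z.2.2 :=
      Primrec.snd.comp Primrec.snd
    exact Primrec.ite
      (Primrec.eq.comp (Primrec.list_head?.comp word) (Primrec.option_some.comp letter))
      (Primrec.list_tail.comp word) word
  exact (PrimrecRel.comp Primrec.eq (Primrec.list_foldl Primrec.snd Primrec.fst h)
    (Primrec.const [])).of_eq fun p => foldl_eq_nil_iff_sublist p.1 p.2

end Sublist

section Evaluation

open Language

variable {A : Type*} [Primcodable A] {ι : Type} {α : Type*} [Primcodable α] {t : α → ι → List A}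

theorem primrec_realize_term (ht : ∀ x, Primrec fun s => t s x) {n : ℕ} (xs : Fin n → List A)
    (τ : subwordLanguage[[List A]].Term (ι ⊕ Fin n)) :
    Primrec fun s => τ.realize (Sum.elim (t s) xs) := by
  rcases τ with (x | x) | ⟨f | f, ts⟩
  · exact ht x
  · exact Primrec.const _
  · exact f.elim
  · rename_i m
    cases m with
    | zero => exact Primrec.const _
    | succ m => exact f.elim

theorem primrecPred_realize (ht : ∀ x, Primrec fun s => t s x) {n : ℕ} (xs : Fin n → List A)
    {φ : subwordLanguage[[List A]].BoundedFormula ι n} (hφ : φ.IsQF) :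
    PrimrecPred fun s => φ.Realize (t s) xs := by
  induction hφ with
  | falsum => exact ⟨fun _ => .isFalse id, Primrec.const false⟩
  | of_isAtomic h =>
    cases h with
    | equal τ σ =>
      classical
      exact Primrec.eq.comp (primrec_realize_term ht xs τ) (primrec_realize_term ht xs σ)
    | rel r ts =>
      obtain ⟨⟨⟩⟩ | r := r
      · exact primrecRel_sublist.comp (primrec_realize_term ht xs (ts 0))
          (primrec_realize_term ht xs (ts 1))
      · exact r.elim
  | imp _ _ h₁ h₂ =>
    exact (h₁.not.or h₂).of_eq fun s => by rw [BoundedFormula.realize_imp, imp_iff_not_or]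

theorem SigDef.arithmeticalSigma {i : ℕ} {R : (ι → List A) → Prop} (h : WordDef A i R)
    {t : ℕ → ι → List A} (ht : ∀ x, Primrec fun n => t n x) :
    ArithmeticalSigma i {n | R (t n)} := by
  induction i generalizing ι with
  | zero =>
    obtain ⟨φ, hφ, e⟩ := h
    exact (primrecPred_realize ht _ hφ).computablePred.of_eq fun n => e (t n)
  | succ i ih =>
    obtain ⟨κ, hκ, R', hR', e⟩ := h
    obtain ⟨m, ⟨f⟩⟩ := Finite.exists_equiv_fin κ
    have h : ArithmeticalSigma i
        {n | R' (Sum.elim (t n.unpair.1) (decodeD (Fin m → List A) n.unpair.2 ∘ f))} := by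
      refine ih hR' ?_
      rintro (x | x)
      · exact (ht x).comp (Primrec.fst.comp Primrec.unpair)
      · exact Primrec.fin_app.comp (primrec_decodeD.comp (Primrec.snd.comp Primrec.unpair))
          (Primrec.const (f x))
    have hsurj : Function.Surjective fun n => decodeD (Fin m → List A) n ∘ f :=
      (f.arrowCongr (Equiv.refl (List A))).symm.surjective.comp decodeD_surjective
    convert h.exists_not_mem using 1
    ext n
    simp only [Set.mem_ofPred_eq, Nat.unpair_pair, e]
    exact hsurj.exists

theorem SigDef.inSigmaZero [Nonempty A] {i : ℕ} {R : (ι → List A) → Prop} (h : WordDef A i R)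
    [Inhabited α] (ht : ∀ x, Primrec fun s => t s x) : InSigmaZero i {s | R (t s)} := by
  obtain ⟨a⟩ := ‹Nonempty A›
  -- The variable `none` tests whether a number is a code.
  have h' : WordDef A i fun v : Option ι → List A => v none = [] ∧ R (v ∘ some) :=
    .and (.eq_const _ _) (h.reindex some)
  have := h'.arithmeticalSigma (t := fun n x => x.elim
    (if Encodable.encode (decodeD α n) = n then [] else [a]) (t (decodeD α n))) ?_
  · unfold InSigmaZero
    convert this using 1
    ext n
    rw [mem_image_encode_iff]
    exact and_congr (by simp) Iff.rfl
  · rintro (_ | x)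
    · exact Primrec.ite (Primrec.eq.comp (Primrec.encode.comp primrec_decodeD) Primrec.id)
        (Primrec.const []) (Primrec.const [a])
    · exact (ht x).comp primrec_decodeD

end Evaluation

theorem hasThirdLetter_of_card {A : Type*} [Fintype A] (hA : 3 ≤ Fintype.card A) :
    HasThirdLetter A := by
  classical
  refine { Fintype.one_lt_card_iff_nontrivial.1 (by lia) with exists_third := fun p q => ?_ }
  obtain ⟨r, hr⟩ := Finset.exists_mem_notMem_of_card_lt_card (s := {p, q}) (t := Finset.univ)
    (Finset.card_le_two.trans_lt hA)
  exact ⟨r, by simpa using hr⟩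

theorem corollary2p2 {A : Type*} [Fintype A] [Primcodable A] (hA : 3 ≤ Fintype.card A)
    (i : ℕ) (hi : 1 ≤ i) (k : ℕ) (R : Set (Fin k → List A)) :
    SigmaDefinable i R ↔ InSigmaZero i R := by
  have := hasThirdLetter_of_card hA
  obtain ⟨i, rfl⟩ := Nat.exists_eq_add_of_le' hi
  rw [sigmaDefinable_iff_wordDef]
  exact ⟨fun h => h.inSigmaZero fun x => Primrec.fin_app.comp Primrec.id (Primrec.const x),
    SigDef.of_inSigmaZero⟩
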